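/- Let $k$ be a field. For $p\ge 1$ let $\mathbb A_p$ be the quiver $1\to 2\to\cdots\to p$. By a module over a product of such quivers and opposite quivers (all squares being required to commute) we mean a finite-dimensional right module, i.e. a representation by finite-dimensional $k$-vector spaces, where an arrow $a\to b$ of $\mathbb A_p$ acts by a map from the component at $a$ to the component at $b$. Let $D\mathcal A_p$ and $D\mathcal A_{p,q}$ be the bounded derived categories of modules over $\mathbb A_p$ and over $\mathbb A_p\times\mathbb A_q$, with shift functor $S$. The standard module with a given (convex) set of vertices as support has a copy of $k$ at each vertex of the support, $0$ elsewhere, and identity maps between vertices of the support. Let $N_p$ be the standard $\mathbb A_p^{op}\times\mathbb A_p$-module with support $\{(a,b)\mid a\ge b\}$. For $m,n\ge 1$ and $1\le i\le m$, let $\mathsf S_{m;i}^n$ be the set of $(\gamma,\mu,\nu)\in[1,m+n-1]\times[1,m]\times[1,n]$ such that ($\mu\le i-1$ and $\gamma\le\mu$) or ($\mu=i$ and $\gamma\le i+\nu-1$) or ($\mu\ge i+1$ and $\gamma\le\mu+n-1$), let $M_{m;i}^n$ be the standard $\mathbb A_{m+n-1}^{op}\times\mathbb A_m\times\mathbb A_n$-module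 with support $\mathsf S_{m;i}^n$, and let $\nabla_{m;i}^n={?}\otimes^L_{\mathbb A_{m+n-1}}M_{m;i}^n: D\mathcal A_{m+n-1}\to D\mathcal A_{m,n}$. Let $\nu_p={?}\otimes^L_{\mathbb A_p}\mathrm D(A_p): D\mathcal A_p\to D\mathcal A_p$ be the Nakayama functor, where $\mathrm D(A_p)$ is the $k$-dual of the path algebra $A_p$ of $\mathbb A_p$, and let $\tau_p=\nu_pS^{-1}$ be the Auslander–Reiten translation. Let $\tau_m\times\mathrm{Id}=({?}\otimes^L_{\mathbb A_m}\mathrm D(A_m))\,S^{-1}$ be the corresponding functor $D\mathcal A_{m,n}\to D\mathcal A_{m,n}$, acting through the first factor. For a subset $\mathsf S$ of a box $[1,d_1]\times\cdots\times[1,d_r]$ and a direction $a$: if $\mathsf S$ is projective in the direction $a$ (stable under increasing the $a$-th coordinate inside the box), its fiber-reversal in the direction $a$ is the set of points of the box which, after decreasing the $a$-th coordinate by $1$, are not in $\mathsf S$; if $\mathsf S$ is injective in the direction $a$ (stable under decreasing the $a$-th coordinate inside the box), its fiber-reversal is the set of points of the box which, after increasing the $a$-th coordinate by $1$, are not in $\mathsf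 S$. **Theorem.** Let $n\ge 1$ and $2\le i\le m$. 1. The set $\mathsf S_{m;i}^n$ is injective in the direction $\gamma$ (of length $m+n-1$), the set $\mathsf S_{m;i-1}^n$ is projective in the direction $\mu$ (of length $m$), and the fiber-reversal of $\mathsf S_{m;i}^n$ in the direction $\gamma$ coincides with the fiber-reversal of $\mathsf S_{m;i-1}^n$ in the direction $\mu$. 2. In the derived category of $\mathbb A_{m+n-1}^{op}\times\mathbb A_m\times\mathbb A_n$-modules, $$N_{m+n-1}\otimes^L_{\mathbb A_{m+n-1}}M_{m;i}^n\;\simeq\;M_{m;i-1}^n\otimes^L_{\mathbb A_m}N_m .$$ 3. There is a natural isomorphism of functors $D\mathcal A_{m+n-1}\to D\mathcal A_{m,n}$ $$\nabla_{m;i}^n\,\tau_{m+n-1}\;\simeq\;(\tau_m\times\mathrm{Id})\,\nabla_{m;i-1}^n .$$ Here the derived tensor products are the total left derived functors of the tensor product functors $?\otimes B$; part of the assertion is that they exist and preserve bounded objects. -/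

import Mathlib

open CategoryTheory CategoryTheory.Limits MonoidalCategory Opposite

universe w u

/-! ### Supports and fiber-reversal -/

namespace Dias

/-- The box `[1,d_1] × ⋯ × [1,d_r]` of integer points. -/
def box {r : ℕ} (d : Fin r → ℕ) : Set (Fin r → ℕ) :=
  {v | ∀ a, 1 ≤ v a ∧ v a ≤ d a}

/-- `S` is projective in the direction `a`: it is stable under increasing the `a`-th coordinate
inside the box. -/
def ProjectiveDir {r : ℕ} (d : Fin r → ℕ) (S : Set (Fin r → ℕ)) (a : Fin r) : Prop :=
  ∀ v ∈ S, ∀ l, v a ≤ l → l ≤ d a → Function.update v a l ∈ S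

/-- `S` is injective in the direction `a`: it is stable under decreasing the `a`-th coordinate
inside the box. -/
def InjectiveDir {r : ℕ} (S : Set (Fin r → ℕ)) (a : Fin r) : Prop :=
  ∀ v ∈ S, ∀ l, 1 ≤ l → l ≤ v a → Function.update v a l ∈ S

/-- The fiber-reversal in the direction `a` of a set `S` which is projective in that direction.
(If `v a = 1`, the modified point is outside of the box, hence not in `S`.) -/
def fiberReversalProj {r : ℕ} (d : Fin r → ℕ) (S : Set (Fin r → ℕ)) (a : Fin r) :
    Set (Fin r → ℕ) :=
  {v | v ∈ box d ∧ Function.update v a (v a - 1) ∉ S}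

/-- The fiber-reversal in the direction `a` of a set `S` which is injective in that direction. -/
def fiberReversalInj {r : ℕ} (d : Fin r → ℕ) (S : Set (Fin r → ℕ)) (a : Fin r) :
    Set (Fin r → ℕ) :=
  {v | v ∈ box d ∧ Function.update v a (v a + 1) ∉ S}

/-- The set `S_{m;i}^n` of triples `(γ, μ, ν)` in `[1,m+n-1] × [1,m] × [1,n]`
(coordinates `0`, `1`, `2`) with `μ ≤ i-1` and `γ ≤ μ`, or `μ = i` and `γ ≤ i+ν-1`,
or `i+1 ≤ μ` and `γ ≤ μ+n-1`. -/
def S (m n i : ℕ) : Set (Fin 3 → ℕ) :=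
  {v | v ∈ box ![m + n - 1, m, n] ∧
    ((v 1 + 1 ≤ i ∧ v 0 ≤ v 1) ∨ (v 1 = i ∧ v 0 + 1 ≤ i + v 2) ∨
      (i + 1 ≤ v 1 ∧ v 0 + 1 ≤ v 1 + n))}

/-! ### Modules over products of quivers of type `A` -/

/-- The vertices `1, …, n` of the quiver `1 → 2 → ⋯ → n`. As a category (via its order) this is
the free category on that quiver; in products of such categories, all squares commute. -/
abbrev Vertex (n : ℕ) : Type := Set.Icc 1 n

/-- Finite-dimensional modules over the quiver with relations underlying `J`: representations of
the category `J` in finite-dimensional `k`-vector spaces. For `J = Vertex n`, these are the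
finite-dimensional right modules over the path algebra of `1 → ⋯ → n`, where a path from `a` to
`b` acts as a linear map from the component at `a` to the component at `b`. -/
abbrev FDMod (k : Type u) [Field k] (J : Type) [SmallCategory J] : Type (u + 1) :=
  J ⥤ FGModuleCat.{u} k

section

variable (k : Type u) [Field k]

/-- The standard module with support `T`: a copy of `k` at each vertex in `T` (and zero
elsewhere), with identity maps between the vertices of `T`. The convexity of the support is what
makes this a functor. -/
noncomputable def standardModule {J : Type} [SmallCategory J] (T : Set J)
    (hT : ∀ ⦃a b c : J⦄, (a ⟶ b) → (b ⟶ c) → a ∈ T → c ∈ T → b ∈ T) : FDMod k J := by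
  classical
  exact
  { obj := fun a => FGModuleCat.of k (PLift (a ∈ T) → k)
    map := fun {a b} _ => FGModuleCat.ofHom
      { toFun := fun φ _ => if ha : a ∈ T then φ ⟨ha⟩ else 0
        map_add' := fun φ ψ => by ext; by_cases ha : a ∈ T <;> simp [ha]
        map_smul' := fun c φ => by ext; by_cases ha : a ∈ T <;> simp [ha] }
    map_id := fun a => by
      apply ConcreteCategory.hom_ext
      intro φ
      funext ⟨ha⟩
      exact dif_pos ha
    map_comp := fun {a b c} f g => by
      apply ConcreteCategory.hom_ext
      intro φ
      funext ⟨hc⟩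
      change (if ha : a ∈ T then φ ⟨ha⟩ else 0) =
        (if _hb : b ∈ T then (if ha : a ∈ T then φ ⟨ha⟩ else 0) else 0)
      by_cases ha : a ∈ T
      · have hb : b ∈ T := hT f g ha hc
        simp [ha, hb]
      · simp [ha] }

/-- The dual `D(A)` of the path algebra `A` of `C`, as a `Cᵒᵖ × C`-module: the component at
`(a, b)` is the space of linear forms on the span of the morphisms `b ⟶ a`, that is, the space of
functions on this set of morphisms. -/
noncomputable def dualBimodule (C : Type) [SmallCategory C] [FinCategory C] :
    FDMod k (Cᵒᵖ × C) where
  obj x := FGModuleCat.of k ((x.2 ⟶ x.1.unop) → k)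
  map f := FGModuleCat.ofHom
    { toFun := fun φ h => φ (f.2 ≫ h ≫ f.1.unop)
      map_add' := fun _ _ => rfl
      map_smul' := fun _ _ => rfl }
  map_id x := by
    apply ConcreteCategory.hom_ext
    intro φ
    funext h
    change φ (𝟙 _ ≫ h ≫ 𝟙 _) = φ h
    simp
  map_comp {x y z} f g := by
    apply ConcreteCategory.hom_ext
    intro φ
    funext h
    change φ ((f.2 ≫ g.2) ≫ h ≫ (g.1.unop ≫ f.1.unop)) = φ (f.2 ≫ (g.2 ≫ h ≫ g.1.unop) ≫ f.1.unop)
    simp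

/-- The module `M_{m;i}^n` over `A_{m+n-1}ᵒᵖ × A_m × A_n`, standard with support `S_{m;i}^n`. -/
noncomputable def M (m n i : ℕ) :
    FDMod k ((Vertex (m + n - 1))ᵒᵖ × Vertex m × Vertex n) :=
  standardModule k {x | ![x.1.unop.1, x.2.1.1, x.2.2.1] ∈ S m n i} (by
    rintro ⟨⟨γ, hγ⟩, ⟨μ, hμ⟩, ⟨ν, hν⟩⟩ ⟨⟨γ', hγ'⟩, ⟨μ', hμ'⟩, ⟨ν', hν'⟩⟩ _ f _ ha _
    have h0 : γ' ≤ γ := leOfHom f.1.unop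
    have h1 : μ ≤ μ' := leOfHom f.2.1
    have h2 : ν ≤ ν' := leOfHom f.2.2
    simp only [Set.mem_Icc] at hγ hμ hν hγ' hμ' hν'
    simp only [S, box, Set.mem_ofPred_eq, Fin.forall_fin_succ, Matrix.cons_val] at ha ⊢
    simp at ha ⊢
    omega)

/-- The module `N_n` over `A_nᵒᵖ × A_n`, standard with support the `(i, j)` with `i ≥ j`. -/
noncomputable def N (n : ℕ) : FDMod k ((Vertex n)ᵒᵖ × Vertex n) :=
  standardModule k {x | x.2 ≤ x.1.unop} (by
    intro a b c _ g _ hc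
    exact (leOfHom g.2).trans (hc.trans (leOfHom g.1.unop)))

end

/-! ### Tensor products with bimodules -/

section

variable {k : Type u} [Field k] {C D J L : Type}
  [SmallCategory C] [SmallCategory D] [SmallCategory J] [SmallCategory L]

instance hasCoend_FGModuleCat [FinCategory C] (F : Cᵒᵖ ⥤ C ⥤ FGModuleCat.{u} k) : HasCoend F := by
  classical
  have : Fintype (multispanShapeCoend C).L := @Fintype.ofFinite (Arrow C) inferInstance
  have : Fintype (multispanShapeCoend C).R := inferInstanceAs (Fintype C)
  infer_instance

/-- The functor `(c', c) ↦ X (s (c, l)) ⊗ B (c', r l)`, depending functorially on `l`. -/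
noncomputable def tensorIntegrand (s : C × L ⥤ J) (r : L ⥤ D) (B : FDMod k (Cᵒᵖ × D))
    (X : FDMod k J) : L ⥤ Cᵒᵖ ⥤ C ⥤ FGModuleCat.{u} k where
  obj l :=
    { obj := fun c' =>
        { obj := fun c => X.obj (s.obj (c, l)) ⊗ B.obj (c', r.obj l)
          map := fun f => X.map (s.map (Prod.mkHom f (𝟙 l))) ▷ B.obj (c', r.obj l)
          map_id := fun c => by
            rw [← prod_id, s.map_id, X.map_id, id_whiskerRight]
          map_comp := fun f g => by
            rw [← comp_whiskerRight, ← X.map_comp, ← s.map_comp, prod_comp, Category.comp_id] }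
      map := fun g =>
        { app := fun c => X.obj (s.obj (c, l)) ◁ B.map (Prod.mkHom g (𝟙 (r.obj l)))
          naturality := fun _ _ f => (whisker_exchange _ _).symm }
      map_id := fun c => by
        ext1
        funext _
        dsimp only
        rw [← prod_id, B.map_id, MonoidalCategory.whiskerLeft_id]
        rfl
      map_comp := fun f g => by
        ext1
        funext _
        dsimp only [NatTrans.comp_app]
        rw [← MonoidalCategory.whiskerLeft_comp, ← B.map_comp, prod_comp, Category.comp_id] }
  map h :=
    { app := fun c' =>
        { app := fun c =>
            X.map (s.map (Prod.mkHom (𝟙 c) h)) ⊗ₘ B.map (Prod.mkHom (𝟙 c') (r.map h))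
          naturality := fun _ _ f => by
            dsimp only
            rw [← tensorHom_id, ← tensorHom_id, tensorHom_comp_tensorHom,
              tensorHom_comp_tensorHom, ← X.map_comp, ← X.map_comp, ← s.map_comp, ← s.map_comp,
              prod_comp, prod_comp]
            simp }
      naturality := fun _ _ f => by
        ext1
        funext _
        dsimp only [NatTrans.comp_app]
        rw [← id_tensorHom, ← id_tensorHom, tensorHom_comp_tensorHom,
          tensorHom_comp_tensorHom, ← B.map_comp, ← B.map_comp, prod_comp, prod_comp]
        simp }
  map_id l := by
    ext1
    funext _
    ext1
    funext _
    dsimp only [NatTrans.id_app]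
    rw [r.map_id, ← prod_id, ← prod_id, s.map_id, X.map_id, B.map_id, id_tensorHom_id]
  map_comp f g := by
    ext1
    funext _
    ext1
    funext _
    dsimp only [NatTrans.comp_app]
    rw [tensorHom_comp_tensorHom, ← X.map_comp, ← B.map_comp, ← s.map_comp, prod_comp, prod_comp,
      r.map_comp, Category.comp_id, Category.comp_id]

/-- The functoriality of `tensorIntegrand` in the module `X`. -/
noncomputable def tensorIntegrandMap (s : C × L ⥤ J) (r : L ⥤ D) (B : FDMod k (Cᵒᵖ × D))
    {X Y : FDMod k J} (α : X ⟶ Y) : tensorIntegrand s r B X ⟶ tensorIntegrand s r B Y where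
  app l :=
    { app := fun c' =>
        { app := fun c => α.app (s.obj (c, l)) ▷ B.obj (c', r.obj l)
          naturality := fun _ _ f => by
            dsimp only [tensorIntegrand]
            rw [← comp_whiskerRight, ← comp_whiskerRight, α.naturality] }
      naturality := fun _ _ f => by
        ext1
        funext _
        exact whisker_exchange _ _ }
  naturality l l' h := by
    ext1
    funext _
    ext1
    funext _
    dsimp only [tensorIntegrand, NatTrans.comp_app]
    rw [← tensorHom_id, ← tensorHom_id, tensorHom_comp_tensorHom, tensorHom_comp_tensorHom,
      α.naturality]
    simp

lemma tensorIntegrandMap_id (s : C × L ⥤ J) (r : L ⥤ D) (B : FDMod k (Cᵒᵖ × D))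
    (X : FDMod k J) : tensorIntegrandMap s r B (𝟙 X) = 𝟙 _ := by
  ext1
  funext _
  ext1
  funext _
  ext1
  funext _
  exact id_whiskerRight _ _

lemma tensorIntegrandMap_comp (s : C × L ⥤ J) (r : L ⥤ D) (B : FDMod k (Cᵒᵖ × D))
    {X Y Z : FDMod k J} (α : X ⟶ Y) (β : Y ⟶ Z) :
    tensorIntegrandMap s r B (α ≫ β) =
      tensorIntegrandMap s r B α ≫ tensorIntegrandMap s r B β := by
  ext1
  funext _
  ext1
  funext _
  ext1
  funext _
  exact comp_whiskerRight _ _ _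

/-- Tensor product with a bimodule, over (the path algebra of) `C`. Here `B` is a left module over
`C`, with a further right action of `D`. The modules `X` to be tensored are indexed by `J`, of
which `C` is a factor, and the result is indexed by `L`. The functors `s` and `r` tell which
components enter the component of index `l` of the tensor product:
`(X ⊗_C B)(l) = ∫^c X (s (c, l)) ⊗ B (c, r l)`, which is the quotient of
`⨁_c X (s (c, l)) ⊗ B (c, r l)` by the relations `x f ⊗ b = x ⊗ f b` for the arrows `f` of `C`. -/
noncomputable def tensor [FinCategory C] (s : C × L ⥤ J) (r : L ⥤ D) (B : FDMod k (Cᵒᵖ × D)) :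
    FDMod k J ⥤ FDMod k L where
  obj X := tensorIntegrand s r B X ⋙ coendFunctor C (FGModuleCat.{u} k)
  map α := Functor.whiskerRight (tensorIntegrandMap s r B α) (coendFunctor C (FGModuleCat.{u} k))
  map_id X := by
    rw [tensorIntegrandMap_id]
    exact Functor.whiskerRight_id' _
  map_comp α β := by
    rw [tensorIntegrandMap_comp]
    exact Functor.whiskerRight_comp _ _ _

instance tensor_additive [FinCategory C] (s : C × L ⥤ J) (r : L ⥤ D) (B : FDMod k (Cᵒᵖ × D)) :
    (tensor s r B).Additive where
  map_add {X Y α β} := by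
    ext1
    funext l
    apply coend.hom_ext
    intro c
    change coend.ι _ c ≫ coend.map ((tensorIntegrandMap s r B (α + β)).app l) =
      coend.ι _ c ≫ (coend.map ((tensorIntegrandMap s r B α).app l) +
        coend.map ((tensorIntegrandMap s r B β).app l))
    rw [Preadditive.comp_add, coend.ι_map, coend.ι_map, coend.ι_map, ← Preadditive.add_comp]
    congr 1
    exact MonoidalPreadditive.add_whiskerRight _ _

end

/-! ### Left derived functors on bounded derived categories -/

section

open DerivedCategory DerivedCategory.TStructure

variable {A B : Type*} [Category* A] [Category* B] [Abelian A] [Abelian B]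
  [HasDerivedCategory A] [HasDerivedCategory B]

/-- A left derived functor of an additive functor `F` which preserves the bounded derived
categories: `total` is a total left derived functor of `F` (i.e. it is universal among the
functors on the derived category which are endowed with a natural transformation to `F` on
complexes), and it sends bounded objects to bounded objects. -/
structure LeftDerived (F : A ⥤ B) [F.Additive] where
  total : DerivedCategory A ⥤ DerivedCategory B
  counit : Q ⋙ total ⟶ F.mapHomologicalComplex (ComplexShape.up ℤ) ⋙ Q
  isLeftDerived :
    total.IsLeftDerivedFunctor counit (HomologicalComplex.quasiIso A (ComplexShape.up ℤ))
  bounded_total (X : DerivedCategory A) (hX : t.bounded X) : t.bounded (total.obj X)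

/-- The left derived functor, between the bounded derived categories. -/
noncomputable def LeftDerived.onBounded {F : A ⥤ B} [F.Additive] (LF : LeftDerived F) :
    Bounded A ⥤ Bounded B :=
  t.bounded.lift (Bounded.ι ⋙ LF.total) (fun X => LF.bounded_total _ X.property)

/-- The left derived functor, applied to an object of the abelian category (in degree `0`). -/
noncomputable def LeftDerived.onObject {F : A ⥤ B} [F.Additive] (LF : LeftDerived F) (X : A) :
    DerivedCategory B :=
  LF.total.obj ((singleFunctor A 0).obj X)

/-- The Auslander-Reiten translation `τ = ν S⁻¹ = ν[-1]` attached to the Nakayama functor `ν`. -/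
noncomputable def LeftDerived.translation {F : A ⥤ B} [F.Additive] (LF : LeftDerived F) :
    Bounded A ⥤ Bounded B :=
  LF.onBounded ⋙ shiftFunctor (Bounded B) (-1 : ℤ)

end

/-! ### The functors of the theorem -/

section

variable (k : Type u) [Field k]

/-- `∇_{m;i}^n = ? ⊗ M_{m;i}^n`, from `A_{m+n-1}`-modules to `A_m × A_n`-modules:
the component at `(μ, ν)` is `∫^γ X (γ) ⊗ M_{m;i}^n (γ, μ, ν)`. -/
noncomputable abbrev nabla (m n i : ℕ) :
    FDMod k (Vertex (m + n - 1)) ⥤ FDMod k (Vertex m × Vertex n) :=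
  tensor (C := Vertex (m + n - 1))
    { obj := fun x => x.1, map := fun f => f.1 } (𝟭 (Vertex m × Vertex n)) (M k m n i)

/-- The Nakayama functor `? ⊗ D(A_n)` on `A_n`-modules. -/
noncomputable abbrev nakayama (n : ℕ) : FDMod k (Vertex n) ⥤ FDMod k (Vertex n) :=
  tensor (C := Vertex n)
    { obj := fun x => x.1, map := fun f => f.1 } (𝟭 (Vertex n)) (dualBimodule k (Vertex n))

/-- The functor `ν_m × Id`, i.e. the Nakayama functor `? ⊗_{A_m} D(A_m)` with respect to the first
factor, on `A_m × A_n`-modules: the component at `(μ, ν)` is `∫^c X (c, ν) ⊗ D(A_m) (c, μ)`. -/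
noncomputable abbrev nakayamaProdId (m n : ℕ) :
    FDMod k (Vertex m × Vertex n) ⥤ FDMod k (Vertex m × Vertex n) :=
  tensor (C := Vertex m)
    { obj := fun x => (x.1, x.2.2), map := fun f => Prod.mkHom f.1 f.2.2 }
    { obj := fun l => l.1, map := fun f => f.1 } (dualBimodule k (Vertex m))

/-- `? ⊗_{A_{m+n-1}} M_{m;i}^n`, from `A_{m+n-1}`-bimodules to
`A_{m+n-1}ᵒᵖ × A_m × A_n`-modules:
the component at `(α, μ, ν)` is `∫^γ X (α, γ) ⊗ M_{m;i}^n (γ, μ, ν)`. -/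
noncomputable abbrev tensorM (m n i : ℕ) :
    FDMod k ((Vertex (m + n - 1))ᵒᵖ × Vertex (m + n - 1)) ⥤
      FDMod k ((Vertex (m + n - 1))ᵒᵖ × Vertex m × Vertex n) :=
  tensor (C := Vertex (m + n - 1))
    { obj := fun x => (x.2.1, x.1), map := fun f => Prod.mkHom f.2.1 f.1 }
    { obj := fun l => l.2, map := fun f => f.2 } (M k m n i)

/-- `? ⊗_{A_m} N_m` on `A_pᵒᵖ × A_m × A_n`-modules:
the component at `(γ, μ, ν)` is `∫^c X (γ, c, ν) ⊗ N_m (c, μ)`. -/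
noncomputable abbrev tensorN (p m n : ℕ) :
    FDMod k ((Vertex p)ᵒᵖ × Vertex m × Vertex n) ⥤
      FDMod k ((Vertex p)ᵒᵖ × Vertex m × Vertex n) :=
  tensor (C := Vertex m)
    { obj := fun x => (x.2.1, x.1, x.2.2.2),
      map := fun f => Prod.mkHom f.2.1 (Prod.mkHom f.1 f.2.2.2) }
    { obj := fun l => l.2.1, map := fun f => f.2.1 } (N k m)

end

end Dias

/-! Everything reduces to one formula. Let `B` be a standard bimodule whose support, over each
vertex `l`, is an interval `[lo l, hi l]` in the contracted direction. In the tensor product every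
generator slides up to the vertex `hi l`, and what comes from below `lo l` dies. Hence `(X ⊗ B)(l)`
is the cokernel of `X(lo l - 1) → X(hi l)`, with zero source when `lo l = 1`
(`exact_belowToTop_topToTensor`). Both terms are exact in `X`, so the cone of this map descends to
derived categories. It is the left derived functor because the map is injective on free modules,
which provide enough resolutions (`LeftDerived.ofPresentation`, `mono_belowToTop_free`).

Write `e_i(μ, ν)` for `fiberEnd n i μ ν`. The fibre of `M_{m;i}^n` over `(μ, ν)` is `[1, e_i(μ,
ν)]`, so `∇_{m;i}^n` is restriction along `e_i`, an exact functor. The fibre of `D(A_p)`, like that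
of `N_p`, over `b` is `[b, p]`, so the derived Nakayama functor is the cone of `X(b - 1) → X(p)`.
Therefore `∇_i ν` is the cone of `X(e_i(μ, ν) - 1) → X(m + n - 1)`, while `(ν × Id) ∇_{i-1}` is the
cone of `X(e_{i-1}(μ - 1, ν)) → X(e_{i-1}(m, ν))`. They agree by three identities: `e_i(1, ν) = 1`,
`e_i(μ, ν) - 1 = e_{i-1}(μ - 1, ν)` for `μ > 1`, and `e_{i-1}(m, ν) = m + n - 1` (`one_lt_fiberEnd`,
`pred_fiberEnd`, `fiberEnd_last`).

For the bimodules, both sides are standard with support `e_i(μ, ν) ≤ α`. On the side of `N_m` the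
map whose cone is taken is already injective on `M_{m;i-1}^n`, so the derived tensor product is the
ordinary one. -/

namespace Dias

/-! ### Left derived functors from functorial resolutions -/

section

variable {C D H : Type*} [Category* C] [Category* D] [Category* H]

/-- If there are functorial resolutions on which the counit is invertible, then the counit exhibits
a left derived functor. -/
lemma isLeftDerivedFunctor_of_resolution {L : C ⥤ D} {W : MorphismProperty C} [L.IsLocalization W]
    {F : C ⥤ H} (LF : D ⥤ H) (α : L ⋙ LF ⟶ F) (R : C ⥤ C) (ε : R ⟶ 𝟭 C)
    (hε : ∀ X, W (ε.app X)) (hα : ∀ X, IsIso (α.app (R.obj X))) :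
    LF.IsLeftDerivedFunctor α W := by
  have hL : ∀ X, IsIso (L.map (ε.app X)) := fun X => Localization.inverts L W _ (hε X)
  have : IsIso (Functor.whiskerRight ε L) := by
    have : ∀ X, IsIso ((Functor.whiskerRight ε L).app X) := hL
    exact NatIso.isIso_of_isIso_app _
  have : IsIso (Functor.whiskerLeft R α) := by
    have : ∀ X, IsIso ((Functor.whiskerLeft R α).app X) := hα
    exact NatIso.isIso_of_isIso_app _
  have key : ∀ (G : D ⥤ H) (β : L ⋙ G ⟶ F), ∃ γ : G ⟶ LF,
      ∀ X, γ.app (L.obj X) ≫ α.app X = β.app X := by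
    intro G β
    -- The composite `G L X ≅ G L R X → F R X ≅ LF L R X → LF L X`; the second isomorphism is the
    -- counit on the resolution.
    let δ : L ⋙ G ⟶ L ⋙ LF :=
      inv (Functor.whiskerRight (Functor.whiskerRight ε L) G) ≫
        (Functor.whiskerLeft R β ≫ inv (Functor.whiskerLeft R α)) ≫
          Functor.whiskerRight (Functor.whiskerRight ε L) LF
    refine ⟨Localization.liftNatTrans L W (L ⋙ G) (L ⋙ LF) G LF δ, fun X => ?_⟩
    rw [Localization.liftNatTrans_app]
    have h1 := α.naturality (ε.app X)
    have h2 := β.naturality (ε.app X)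
    have := hL X
    have := hα X
    simp [δ, Localization.Lifting.iso] at h1 h2 ⊢
    rw [h1, IsIso.inv_hom_id_assoc, ← h2]
  -- A transformation is determined on the objects `L (R X)`, since `L` inverts `ε`; there the
  -- counit can be cancelled.
  have uniq : ∀ (G : D ⥤ H) (γ γ' : G ⟶ LF),
      (∀ X, γ.app (L.obj X) ≫ α.app X = γ'.app (L.obj X) ≫ α.app X) → γ = γ' := by
    intro G γ γ' h
    apply Localization.natTrans_ext L W
    intro X
    have := hL X
    have := hα X
    have h1 := γ.naturality (L.map (ε.app X))
    have h2 := γ'.naturality (L.map (ε.app X))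
    dsimp only [Functor.id_obj] at h1 h2
    rw [← cancel_epi (G.map (L.map (ε.app X))), h1, h2]
    congr 1
    rw [← cancel_mono (α.app (R.obj X))]
    exact h _
  refine ⟨⟨⟨IsTerminal.ofUniqueHom (fun G => CostructuredArrow.homMk (key G.left G.hom).choose ?_)
    ?_⟩⟩⟩
  · ext X
    exact (key G.left G.hom).choose_spec X
  · intro G f
    ext1
    apply uniq
    intro X
    have h := (key G.left G.hom).choose_spec X
    have h' := NatTrans.congr_app (CostructuredArrow.w f) X
    exact h'.trans h.symm

end

/-! ### The cone of a transformation between additive functors -/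

section

variable {A B : Type*} [Category* A] [Category* B] [Abelian A] [Abelian B]

/-- The mapping cone of a natural transformation, as a functor on complexes. -/
noncomputable def coneFunctor {T₁ T₀ : A ⥤ B} [T₁.Additive] [T₀.Additive] (φ : T₁ ⟶ T₀) :
    CochainComplex A ℤ ⥤ CochainComplex B ℤ where
  obj K := CochainComplex.mappingCone
    ((NatTrans.mapHomologicalComplex φ (ComplexShape.up ℤ)).app K)
  map f := CochainComplex.mappingCone.map _ _ ((T₁.mapHomologicalComplex (ComplexShape.up ℤ)).map f)
    ((T₀.mapHomologicalComplex (ComplexShape.up ℤ)).map f)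
    ((NatTrans.mapHomologicalComplex φ (ComplexShape.up ℤ)).naturality f).symm
  map_id K := by
    have h : ∀ a b comm, a = 𝟙 _ → b = 𝟙 _ → CochainComplex.mappingCone.map
        ((NatTrans.mapHomologicalComplex φ (ComplexShape.up ℤ)).app K)
        ((NatTrans.mapHomologicalComplex φ (ComplexShape.up ℤ)).app K) a b comm = 𝟙 _ := by
      rintro _ _ comm rfl rfl
      exact CochainComplex.mappingCone.map_id _
    exact h _ _ _ (CategoryTheory.Functor.map_id _ _) (CategoryTheory.Functor.map_id _ _)
  map_comp f g := by
    simp only [Functor.map_comp]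
    exact CochainComplex.mappingCone.map_comp _ _ _ _ _ _ _ _ _

/-- A short complex of functors, evaluated at a complex. -/
noncomputable def evalComplex {T₁ T₀ F : A ⥤ B} [T₁.Additive] [T₀.Additive] [F.Additive]
    (φ : T₁ ⟶ T₀) (ψ : T₀ ⟶ F) (hφψ : φ ≫ ψ = 0) (K : CochainComplex A ℤ) :
    ShortComplex (CochainComplex B ℤ) :=
  ShortComplex.mk ((NatTrans.mapHomologicalComplex φ (ComplexShape.up ℤ)).app K)
    ((NatTrans.mapHomologicalComplex ψ (ComplexShape.up ℤ)).app K) (by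
      ext n
      exact NatTrans.congr_app hφψ (K.X n))

/-- A short complex of functors, evaluated at an object. -/
noncomputable def evalObj {T₁ T₀ F : A ⥤ B} (φ : T₁ ⟶ T₀) (ψ : T₀ ⟶ F) (hφψ : φ ≫ ψ = 0) (X : A) :
    ShortComplex B :=
  ShortComplex.mk (φ.app X) (ψ.app X) (NatTrans.congr_app hφψ X)

/-- The natural map from the cone of `φ` to any functor through which it factors. -/
noncomputable def coneDesc {T₁ T₀ F : A ⥤ B} [T₁.Additive] [T₀.Additive] [F.Additive]
    (φ : T₁ ⟶ T₀) (ψ : T₀ ⟶ F) (hφψ : φ ≫ ψ = 0) :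
    coneFunctor φ ⟶ F.mapHomologicalComplex (ComplexShape.up ℤ) where
  app K := CochainComplex.mappingCone.descShortComplex (evalComplex φ ψ hφψ K)
  naturality K L f := CochainComplex.mappingCone.descShortComplex_naturality
    (S₁ := evalComplex φ ψ hφψ K) (S₂ := evalComplex φ ψ hφψ L)
    { τ₁ := (T₁.mapHomologicalComplex (ComplexShape.up ℤ)).map f
      τ₂ := (T₀.mapHomologicalComplex (ComplexShape.up ℤ)).map f
      τ₃ := (F.mapHomologicalComplex (ComplexShape.up ℤ)).map f
      comm₁₂ := ((NatTrans.mapHomologicalComplex φ (ComplexShape.up ℤ)).naturality f)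
      comm₂₃ := ((NatTrans.mapHomologicalComplex ψ (ComplexShape.up ℤ)).naturality f) }

/-- The cone of a termwise injective map of complexes is quasi-isomorphic to its cokernel. This is
how the cone of `φ` comes to compute `F` on acyclic terms. -/
lemma quasiIso_coneDesc_app {T₁ T₀ F : A ⥤ B} [T₁.Additive] [T₀.Additive] [F.Additive]
    (φ : T₁ ⟶ T₀) (ψ : T₀ ⟶ F) (hφψ : φ ≫ ψ = 0) (K : CochainComplex A ℤ)
    (hK : ∀ n, (evalObj φ ψ hφψ (K.X n)).ShortExact) :
    QuasiIso ((coneDesc φ ψ hφψ).app K) :=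
  CochainComplex.mappingCone.quasiIso_descShortComplex
    (HomologicalComplex.shortExact_of_degreewise_shortExact _ hK)

end

/-! ### Descent of the cone to derived categories -/

section

open DerivedCategory Pretriangulated

variable {A B : Type*} [Category* A] [Category* B] [Abelian A] [Abelian B] [HasDerivedCategory B]

lemma coneFunctor_distinguished {T₁ T₀ : A ⥤ B} [T₁.Additive] [T₀.Additive] (φ : T₁ ⟶ T₀)
    (K : CochainComplex A ℤ) :
    Q.mapTriangle.obj (CochainComplex.mappingCone.triangle
      ((NatTrans.mapHomologicalComplex φ (ComplexShape.up ℤ)).app K)) ∈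
        (distTriang (DerivedCategory B)) :=
  (mem_distTriang_iff _).2 ⟨_, _, _, ⟨Iso.refl _⟩⟩

variable {T₁ T₀ : A ⥤ B} [T₁.Additive] [T₀.Additive]
  [PreservesFiniteLimits T₁] [PreservesFiniteColimits T₁]
  [PreservesFiniteLimits T₀] [PreservesFiniteColimits T₀] (φ : T₁ ⟶ T₀)

/-- The exact functors `T₁` and `T₀` preserve quasi-isomorphisms; the distinguished triangle of the
cone transfers this to the third vertex. -/
lemma isInvertedBy_coneFunctor :
    (HomologicalComplex.quasiIso A (ComplexShape.up ℤ)).IsInvertedBy (coneFunctor φ ⋙ Q) := by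
  intro K L f (hf : QuasiIso f)
  let τ := Q.mapTriangle.map (CochainComplex.mappingCone.triangleMap _ _
    ((T₁.mapHomologicalComplex (ComplexShape.up ℤ)).map f)
    ((T₀.mapHomologicalComplex (ComplexShape.up ℤ)).map f)
    ((NatTrans.mapHomologicalComplex φ (ComplexShape.up ℤ)).naturality f).symm)
  have h1 : QuasiIso ((T₁.mapHomologicalComplex (ComplexShape.up ℤ)).map f) :=
    HomologicalComplex.quasiIso_map_of_preservesHomology _ _
  have h0 : QuasiIso ((T₀.mapHomologicalComplex (ComplexShape.up ℤ)).map f) :=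
    HomologicalComplex.quasiIso_map_of_preservesHomology _ _
  have i1 : IsIso (Q.map ((T₁.mapHomologicalComplex (ComplexShape.up ℤ)).map f)) := inferInstance
  have i0 : IsIso (Q.map ((T₀.mapHomologicalComplex (ComplexShape.up ℤ)).map f)) := inferInstance
  exact Pretriangulated.isIso₃_of_isIso₁₂ τ (coneFunctor_distinguished φ K)
    (coneFunctor_distinguished φ L) i1 i0

end

section

open DerivedCategory DerivedCategory.TStructure Pretriangulated

variable {A B : Type*} [Category* A] [Category* B] [Abelian A] [Abelian B]
  [HasDerivedCategory A] [HasDerivedCategory B]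

/-- Each bound is realised by a complex that is strictly zero beyond it, and applying `T` termwise
keeps zero terms zero. -/
lemma bounded_mapDerivedCategory (T : A ⥤ B) [T.Additive] [PreservesFiniteLimits T]
    [PreservesFiniteColimits T] (X : DerivedCategory A) (hX : t.bounded X) :
    t.bounded (T.mapDerivedCategory.obj X) := by
  obtain ⟨⟨a, ha⟩, ⟨b, hb⟩⟩ := hX
  constructor
  · obtain ⟨K, hK, ⟨e⟩⟩ := X.exists_iso_Q_obj_of_isGE a
    refine ⟨a, ?_⟩
    have : CochainComplex.IsStrictlyGE ((T.mapHomologicalComplex (ComplexShape.up ℤ)).obj K) a := by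
      rw [CochainComplex.isStrictlyGE_iff] at hK ⊢
      exact fun i hi => T.map_isZero (hK i hi)
    have : IsGE (Q.obj ((T.mapHomologicalComplex (ComplexShape.up ℤ)).obj K)) a := inferInstance
    let e' : Q.obj ((T.mapHomologicalComplex (ComplexShape.up ℤ)).obj K) ≅
        T.mapDerivedCategory.obj X :=
      (T.mapDerivedCategory.mapIso e ≪≫ T.mapDerivedCategoryFactors.app K).symm
    exact t.isGE_of_iso e' a
  · obtain ⟨K, hK, ⟨e⟩⟩ := X.exists_iso_Q_obj_of_isLE b
    refine ⟨b, ?_⟩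
    have : CochainComplex.IsStrictlyLE ((T.mapHomologicalComplex (ComplexShape.up ℤ)).obj K) b := by
      rw [CochainComplex.isStrictlyLE_iff] at hK ⊢
      exact fun i hi => T.map_isZero (hK i hi)
    have : IsLE (Q.obj ((T.mapHomologicalComplex (ComplexShape.up ℤ)).obj K)) b := inferInstance
    let e' : Q.obj ((T.mapHomologicalComplex (ComplexShape.up ℤ)).obj K) ≅
        T.mapDerivedCategory.obj X :=
      (T.mapDerivedCategory.mapIso e ≪≫ T.mapDerivedCategoryFactors.app K).symm
    exact t.isLE_of_iso e' b

variable {T₁ T₀ : A ⥤ B} [T₁.Additive] [T₀.Additive]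
  [PreservesFiniteLimits T₁] [PreservesFiniteColimits T₁]
  [PreservesFiniteLimits T₀] [PreservesFiniteColimits T₀] (φ : T₁ ⟶ T₀)

/-- The functor on derived categories induced by the mapping cone of a natural transformation
between exact functors. -/
noncomputable def derivedCone : DerivedCategory A ⥤ DerivedCategory B :=
  Localization.lift _ (isInvertedBy_coneFunctor φ) Q

noncomputable def derivedConeFactors : Q ⋙ derivedCone φ ≅ coneFunctor φ ⋙ Q :=
  Localization.fac _ _ _

/-- The value is the third vertex of a triangle whose other two vertices are bounded. -/
lemma bounded_derivedCone (X : DerivedCategory A) (hX : t.bounded X) :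
    t.bounded ((derivedCone φ).obj X) := by
  let K := Q.objPreimage X
  let e : Q.obj K ≅ X := Q.objObjPreimageIso X
  have h : t.bounded (Q.obj K) := (t.bounded.prop_iff_of_iso e).2 hX
  have h1 := (t.bounded.prop_iff_of_iso (T₁.mapDerivedCategoryFactors.app K)).1
    (bounded_mapDerivedCategory T₁ _ h)
  have h0 := (t.bounded.prop_iff_of_iso (T₀.mapDerivedCategoryFactors.app K)).1
    (bounded_mapDerivedCategory T₀ _ h)
  have h3 := t.bounded.ext_of_isTriangulatedClosed₃ _ (coneFunctor_distinguished φ K) h1 h0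
  exact (t.bounded.prop_iff_of_iso
    ((derivedCone φ).mapIso e.symm ≪≫ (derivedConeFactors φ).app K)).2 h3

end

/-! ### Cones and additive functors -/

section

variable {A B : Type*} [Category* A] [Category* B] [Abelian A] [Abelian B]

open CochainComplex CochainComplex.HomComplex

lemma mappingCone_map_f_fst {K₁ L₁ K₂ L₂ : CochainComplex A ℤ} (φ₁ : K₁ ⟶ L₁) (φ₂ : K₂ ⟶ L₂)
    (a : K₁ ⟶ K₂) (b : L₁ ⟶ L₂) (comm : φ₁ ≫ b = a ≫ φ₂) (n m : ℤ) (h : n + 1 = m) :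
    (mappingCone.map φ₁ φ₂ a b comm).f n ≫ (mappingCone.fst φ₂).1.v n m h =
      (mappingCone.fst φ₁).1.v n m h ≫ a.f m := by
  rw [mappingCone.ext_from_iff _ _ _ h]
  constructor <;> simp [mappingCone.map]

lemma mappingCone_map_f_snd {K₁ L₁ K₂ L₂ : CochainComplex A ℤ} (φ₁ : K₁ ⟶ L₁) (φ₂ : K₂ ⟶ L₂)
    (a : K₁ ⟶ K₂) (b : L₁ ⟶ L₂) (comm : φ₁ ≫ b = a ≫ φ₂) (n : ℤ) :
    (mappingCone.map φ₁ φ₂ a b comm).f n ≫ (mappingCone.snd φ₂).v n n (add_zero n) =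
      (mappingCone.snd φ₁).v n n (add_zero n) ≫ b.f n := by
  rw [mappingCone.ext_from_iff _ _ _ rfl]
  constructor <;> simp [mappingCone.map]

/-- Mapping cones of isomorphic morphisms are isomorphic. -/
noncomputable def mappingConeIso {K₁ L₁ K₂ L₂ : CochainComplex A ℤ} (φ₁ : K₁ ⟶ L₁) (φ₂ : K₂ ⟶ L₂)
    (a : K₁ ≅ K₂) (b : L₁ ≅ L₂) (comm : φ₁ ≫ b.hom = a.hom ≫ φ₂) :
    mappingCone φ₁ ≅ mappingCone φ₂ where
  hom := mappingCone.map φ₁ φ₂ a.hom b.hom comm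
  inv := mappingCone.map φ₂ φ₁ a.inv b.inv (by
    rw [Iso.eq_inv_comp, ← reassoc_of% comm, Iso.hom_inv_id, Category.comp_id])
  hom_inv_id := by
    rw [← mappingCone.map_comp]
    simp only [Iso.hom_inv_id, mappingCone.map_id]
  inv_hom_id := by
    rw [← mappingCone.map_comp]
    simp only [Iso.inv_hom_id, mappingCone.map_id]

lemma mapHomologicalComplexIso_hom_f_fst (G : A ⥤ B) [G.Additive] {K L : CochainComplex A ℤ}
    (f : K ⟶ L) (n m : ℤ) (h : n + 1 = m) :
    (mappingCone.mapHomologicalComplexIso f G).hom.f n ≫ (mappingCone.fst _).1.v n m h =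
      G.map ((mappingCone.fst f).1.v n m h) := by
  subst h
  have e1 := mappingCone.inl_v_fst_v ((G.mapHomologicalComplex (ComplexShape.up ℤ)).map f)
    (n + 1) n (by lia)
  have e2 := mappingCone.inr_f_fst_v ((G.mapHomologicalComplex (ComplexShape.up ℤ)).map f)
    n (n + 1) rfl
  exact (Preadditive.add_comp _ _ _ _ _ _).trans ((congrArg₂ (· + ·)
    ((Category.assoc _ _ _).trans ((congrArg (_ ≫ ·) e1).trans (Category.comp_id _)))
    ((Category.assoc _ _ _).trans ((congrArg (_ ≫ ·) e2).trans comp_zero))).trans (add_zero _))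

lemma mapHomologicalComplexIso_hom_f_snd (G : A ⥤ B) [G.Additive] {K L : CochainComplex A ℤ}
    (f : K ⟶ L) (n : ℤ) :
    (mappingCone.mapHomologicalComplexIso f G).hom.f n ≫ (mappingCone.snd _).v n n (add_zero n) =
      G.map ((mappingCone.snd f).v n n (add_zero n)) := by
  have e1 := mappingCone.inl_v_snd_v ((G.mapHomologicalComplex (ComplexShape.up ℤ)).map f)
    (n + 1) n (by lia)
  have e2 := mappingCone.inr_f_snd_v ((G.mapHomologicalComplex (ComplexShape.up ℤ)).map f) n
  exact (Preadditive.add_comp _ _ _ _ _ _).trans ((congrArg₂ (· + ·)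
    ((Category.assoc _ _ _).trans ((congrArg (_ ≫ ·) e1).trans comp_zero))
    ((Category.assoc _ _ _).trans ((congrArg (_ ≫ ·) e2).trans (Category.comp_id _)))).trans
      (zero_add _))

/-- A map into a cone is determined by its two projections, and both the isomorphism and the map of
cones have known projections. -/
lemma mapHomologicalComplexIso_hom_naturality (G : A ⥤ B) [G.Additive]
    {K₁ L₁ K₂ L₂ : CochainComplex A ℤ} (φ₁ : K₁ ⟶ L₁) (φ₂ : K₂ ⟶ L₂)
    (a : K₁ ⟶ K₂) (b : L₁ ⟶ L₂) (comm : φ₁ ≫ b = a ≫ φ₂) :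
    (G.mapHomologicalComplex (ComplexShape.up ℤ)).map (mappingCone.map φ₁ φ₂ a b comm) ≫
        (mappingCone.mapHomologicalComplexIso φ₂ G).hom =
      (mappingCone.mapHomologicalComplexIso φ₁ G).hom ≫
        mappingCone.map _ _ ((G.mapHomologicalComplex (ComplexShape.up ℤ)).map a)
          ((G.mapHomologicalComplex (ComplexShape.up ℤ)).map b) (by
            rw [← Functor.map_comp, comm, Functor.map_comp]) := by
  ext n
  rw [mappingCone.ext_to_iff _ _ _ rfl]
  constructor
  · have e1 := congrArg G.map (mappingCone_map_f_fst φ₁ φ₂ a b comm n (n + 1) rfl)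
    rw [Functor.map_comp, Functor.map_comp] at e1
    rw [HomologicalComplex.comp_f, HomologicalComplex.comp_f, Category.assoc, Category.assoc,
      mappingCone_map_f_fst, mapHomologicalComplexIso_hom_f_fst,
      reassoc_of% mapHomologicalComplexIso_hom_f_fst]
    exact e1
  · have e1 := congrArg G.map (mappingCone_map_f_snd φ₁ φ₂ a b comm n)
    rw [Functor.map_comp, Functor.map_comp] at e1
    rw [HomologicalComplex.comp_f, HomologicalComplex.comp_f, Category.assoc, Category.assoc,
      mappingCone_map_f_snd, mapHomologicalComplexIso_hom_f_snd,
      reassoc_of% mapHomologicalComplexIso_hom_f_snd]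
    exact e1

lemma mappingCone_map_congr {K₁ L₁ K₂ L₂ : CochainComplex A ℤ} {φ₁ : K₁ ⟶ L₁} {φ₂ : K₂ ⟶ L₂}
    {a a' : K₁ ⟶ K₂} {b b' : L₁ ⟶ L₂} (ha : a = a') (hb : b = b') (comm : φ₁ ≫ b = a ≫ φ₂)
    (comm' : φ₁ ≫ b' = a' ≫ φ₂) :
    mappingCone.map φ₁ φ₂ a b comm = mappingCone.map φ₁ φ₂ a' b' comm' := by
  subst ha hb
  rfl

end

section

variable {A A' B B' : Type*} [Category* A] [Category* A'] [Category* B] [Category* B']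
  [Abelian A] [Abelian A'] [Abelian B] [Abelian B']
  {T₁ T₀ : A ⥤ B} [T₁.Additive] [T₀.Additive] (φ : T₁ ⟶ T₀)
  {T₁' T₀' : A' ⥤ B'} [T₁'.Additive] [T₀'.Additive] (φ' : T₁' ⟶ T₀')
  (G : B ⥤ B') [G.Additive] (G' : A ⥤ A') [G'.Additive]
  (e₁ : T₁ ⋙ G ≅ G' ⋙ T₁') (e₀ : T₀ ⋙ G ≅ G' ⋙ T₀')
  (comm : ∀ X, G.map (φ.app X) ≫ e₀.hom.app X = e₁.hom.app X ≫ φ'.app (G'.obj X))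

open CochainComplex CochainComplex.HomComplex

include comm in
lemma mapComplex_comm (K : CochainComplex A ℤ) :
    (G.mapHomologicalComplex (ComplexShape.up ℤ)).map
      ((NatTrans.mapHomologicalComplex φ (ComplexShape.up ℤ)).app K) ≫
        (NatTrans.mapHomologicalComplex e₀.hom (ComplexShape.up ℤ)).app K =
    (NatTrans.mapHomologicalComplex e₁.hom (ComplexShape.up ℤ)).app K ≫
      (NatTrans.mapHomologicalComplex φ' (ComplexShape.up ℤ)).app
        ((G'.mapHomologicalComplex (ComplexShape.up ℤ)).obj K) := by
  ext n
  exact comm (K.X n)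

/-- The cone of a natural transformation commutes with additive functors. -/
noncomputable def coneFunctorCompIso :
    coneFunctor φ ⋙ G.mapHomologicalComplex (ComplexShape.up ℤ) ≅
      G'.mapHomologicalComplex (ComplexShape.up ℤ) ⋙ coneFunctor φ' :=
  NatIso.ofComponents (fun K => mappingCone.mapHomologicalComplexIso _ G ≪≫
    mappingConeIso _ _
      ((NatIso.mapHomologicalComplex e₁ (ComplexShape.up ℤ)).app K)
      ((NatIso.mapHomologicalComplex e₀ (ComplexShape.up ℤ)).app K)
      (mapComplex_comm φ φ' G G' e₁ e₀ comm K)) (by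
    intro K L f
    refine (Category.assoc _ _ _).symm.trans ?_
    refine (congrArg (· ≫ _) (mapHomologicalComplexIso_hom_naturality G
      ((NatTrans.mapHomologicalComplex φ (ComplexShape.up ℤ)).app K)
      ((NatTrans.mapHomologicalComplex φ (ComplexShape.up ℤ)).app L)
      ((T₁.mapHomologicalComplex (ComplexShape.up ℤ)).map f)
      ((T₀.mapHomologicalComplex (ComplexShape.up ℤ)).map f)
      ((NatTrans.mapHomologicalComplex φ (ComplexShape.up ℤ)).naturality f).symm)).trans ?_
    refine (Category.assoc _ _ _).trans (Eq.trans ?_ (Category.assoc _ _ _).symm)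
    refine congrArg ((mappingCone.mapHomologicalComplexIso _ G).hom ≫ ·) ?_
    refine (mappingCone.map_comp _ _ _ _ _ _ _ _
      (mapComplex_comm φ φ' G G' e₁ e₀ comm L)).symm.trans
      (Eq.trans ?_ (mappingCone.map_comp _ _ _ _ _
        (mapComplex_comm φ φ' G G' e₁ e₀ comm K) _ _
        ((NatTrans.mapHomologicalComplex φ' (ComplexShape.up ℤ)).naturality _).symm))
    exact mappingCone_map_congr
      ((NatTrans.mapHomologicalComplex e₁.hom (ComplexShape.up ℤ)).naturality f)
      ((NatTrans.mapHomologicalComplex e₀.hom (ComplexShape.up ℤ)).naturality f) _ _)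

end

/-! ### Acyclicity of the terms of a resolution -/

section

variable {A B : Type*} [Category* A] [Category* B]

/-- By naturality `φ_X` followed by `T₀ i` is the monomorphism `T₁ i` followed by `φ_Y`. Thus
subobjects of acyclic objects are acyclic, and resolutions of length one suffice. -/
lemma mono_app_of_mono {T₁ T₀ : A ⥤ B} [T₁.PreservesMonomorphisms] (φ : T₁ ⟶ T₀) {X Y : A}
    (i : X ⟶ Y) (hi : Mono i) (hY : Mono (φ.app Y)) : Mono (φ.app X) := by
  have h := mono_comp (T₁.map i) (φ.app Y)
  rw [φ.naturality] at h
  exact mono_of_mono _ (T₀.map i)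

lemma shortExact_evalObj [Abelian B] {T₁ T₀ F : A ⥤ B} (φ : T₁ ⟶ T₀) (ψ : T₀ ⟶ F)
    (hφψ : φ ≫ ψ = 0) (X : A) (hex : (evalObj φ ψ hφψ X).Exact) (hψ : Epi (ψ.app X))
    (hφ : Mono (φ.app X)) : (evalObj φ ψ hφψ X).ShortExact where
  exact := hex
  mono_f := hφ
  epi_g := hψ

end

section

variable {A B : Type*} [Category* A] [Category* B] [Abelian A] [Abelian B]

/-- Additivity can be tested after the componentwise injective inclusion into the additive functor
`E`. -/
instance (E : A ⥤ A) [E.Additive] (π : E ⟶ 𝟭 A) : (kernel π).Additive where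
  map_add {X Y f g} := by
    have hmono : Mono ((kernel.ι π).app Y) := inferInstance
    rw [← cancel_mono ((kernel.ι π).app Y), Preadditive.add_comp, NatTrans.naturality,
      NatTrans.naturality, NatTrans.naturality, ← Preadditive.comp_add, Functor.map_add]

/-- The sequence is short exact in the abelian category of endofunctors, and evaluation at `X` is
exact. -/
lemma shortExact_kernel (E : A ⥤ A) (π : E ⟶ 𝟭 A) (hπ : ∀ X, Epi (π.app X)) (X : A) :
    (evalObj (kernel.ι π) π (kernel.condition π) X).ShortExact := by
  have : Epi π := NatTrans.epi_of_epi_app π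
  have h : (ShortComplex.mk (kernel.ι π) π (kernel.condition π)).ShortExact :=
    { exact := ShortComplex.exact_kernel π }
  exact h.map_of_exact ((evaluation A A).obj X)

/-- The natural transformation `φ` is injective on cones of maps between objects on which it is
injective. -/
lemma mono_app_mappingCone {T₁ T₀ : A ⥤ B} [T₁.Additive] (φ : T₁ ⟶ T₀)
    (K L : CochainComplex A ℤ) (f : K ⟶ L) (hK : ∀ n, Mono (φ.app (K.X n)))
    (hL : ∀ n, Mono (φ.app (L.X n))) (n : ℤ) :
    Mono (φ.app ((CochainComplex.mappingCone f).X n)) := by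
  apply Preadditive.mono_of_cancel_zero
  intro Z g hg
  let p := (CochainComplex.mappingCone.fst f).1.v n (n + 1) rfl
  let q := (CochainComplex.mappingCone.snd f).v n n (add_zero n)
  have hp : g ≫ T₁.map p = 0 := by
    have := hK (n + 1)
    rw [← cancel_mono (φ.app (K.X (n + 1))), Category.assoc, φ.naturality, reassoc_of% hg]
    simp
  have hq : g ≫ T₁.map q = 0 := by
    have := hL n
    rw [← cancel_mono (φ.app (L.X n)), Category.assoc, φ.naturality, reassoc_of% hg]
    simp
  have hid : 𝟙 _ = p ≫ (CochainComplex.mappingCone.inl f).v (n + 1) n (by lia) +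
      q ≫ (CochainComplex.mappingCone.inr f).f n := by
    rw [CochainComplex.mappingCone.ext_from_iff _ _ _ rfl]
    simp [p, q]
  rw [← Category.comp_id g, ← T₁.map_id, hid, T₁.map_add, T₁.map_comp, T₁.map_comp,
    Preadditive.comp_add, reassoc_of% hp, reassoc_of% hq]
  simp

end

/-! ### Left derived functors of cokernels of exact functors -/

section

open DerivedCategory DerivedCategory.TStructure

variable {A B : Type*} [Category* A] [Category* B] [Abelian A] [Abelian B]
  [HasDerivedCategory A] [HasDerivedCategory B]

/-- The left derived functor of an exact functor. -/
noncomputable def LeftDerived.ofExact (F : A ⥤ B) [F.Additive] [PreservesFiniteLimits F]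
    [PreservesFiniteColimits F] : LeftDerived F where
  total := F.mapDerivedCategory
  counit := F.mapDerivedCategoryFactors.hom
  isLeftDerived := isLeftDerivedFunctor_of_resolution _ _ (𝟭 _) (𝟙 _)
    (fun X => inferInstanceAs (QuasiIso (𝟙 X))) (fun _ => inferInstance)
  bounded_total := bounded_mapDerivedCategory F

/-- Uniqueness of the left derived functor. -/
noncomputable def LeftDerived.totalIso {F F' : A ⥤ B} [F.Additive] [F'.Additive] (LF : LeftDerived F)
    (LF' : LeftDerived F') (e : F ≅ F') : LF.total ≅ LF'.total :=
  have := LF.isLeftDerived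
  have := LF'.isLeftDerived
  Functor.leftDerivedNatIso LF.total LF'.total LF.counit LF'.counit
    (HomologicalComplex.quasiIso A (ComplexShape.up ℤ))
    (Functor.isoWhiskerRight (NatIso.mapHomologicalComplex e (ComplexShape.up ℤ)) Q)

section

variable {T₁ T₀ F : A ⥤ B} [T₁.Additive] [T₀.Additive] [F.Additive]
  (φ : T₁ ⟶ T₀) (ψ : T₀ ⟶ F) (hφψ : φ ≫ ψ = 0)

variable [PreservesFiniteLimits T₁] [PreservesFiniteColimits T₁]
  [PreservesFiniteLimits T₀] [PreservesFiniteColimits T₀]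

/-- The counit from the derived cone. -/
noncomputable def derivedConeCounit :
    Q ⋙ derivedCone φ ⟶ F.mapHomologicalComplex (ComplexShape.up ℤ) ⋙ Q :=
  (derivedConeFactors φ).hom ≫ Functor.whiskerRight (coneDesc φ ψ hφψ) Q

lemma isIso_derivedConeCounit_app (K : CochainComplex A ℤ)
    (hK : ∀ n, (evalObj φ ψ hφψ (K.X n)).ShortExact) :
    IsIso ((derivedConeCounit φ ψ hφψ).app K) := by
  have := quasiIso_coneDesc_app φ ψ hφψ K hK
  have h : IsIso (Q.map ((coneDesc φ ψ hφψ).app K)) := inferInstance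
  have h' : IsIso ((Functor.whiskerRight (coneDesc φ ψ hφψ) Q).app K) := h
  unfold derivedConeCounit
  rw [NatTrans.comp_app]
  infer_instance

/-- A functor which is the cokernel of a transformation `φ` between exact functors has a left
derived functor, given by the cone of `φ`, if `φ` is injective on enough objects. -/
noncomputable def LeftDerived.ofPresentation
    (hex : ∀ X, (evalObj φ ψ hφψ X).Exact) (hψ : ∀ X, Epi (ψ.app X))
    (E : A ⥤ A) [E.Additive] (π : E ⟶ 𝟭 A) (hπ : ∀ X, Epi (π.app X))
    (hE : ∀ X, Mono (φ.app (E.obj X))) : LeftDerived F where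
  total := derivedCone φ
  counit := derivedConeCounit φ ψ hφψ
  isLeftDerived := isLeftDerivedFunctor_of_resolution _ _
    (coneFunctor (kernel.ι π))
    (coneDesc (kernel.ι π) π (kernel.condition π) ≫
      (Functor.mapHomologicalComplexIdIso A (ComplexShape.up ℤ)).hom)
    (fun K => by
      have h := quasiIso_coneDesc_app (kernel.ι π) π (kernel.condition π) K
        (fun n => shortExact_kernel E π hπ _)
      have h' : QuasiIso ((Functor.mapHomologicalComplexIdIso A (ComplexShape.up ℤ)).hom.app K) :=
        inferInstance
      exact quasiIso_comp _ _)
    -- In degree `n` the resolution is the sum of `kernel π` at `K.X (n + 1)` and `E` at `K.X n`;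
    -- the first is a subobject of a value of `E`, so `φ` is injective on both.
    (fun K => isIso_derivedConeCounit_app φ ψ hφψ _ (fun n =>
      shortExact_evalObj φ ψ hφψ _ (hex _) (hψ _) (mono_app_mappingCone φ _ _ _
        (fun m => by
          have h : Mono ((kernel.ι π).app (K.X m)) := inferInstance
          exact mono_app_of_mono φ ((kernel.ι π).app (K.X m)) h (hE _))
        (fun m => hE _) n)))
  bounded_total := bounded_derivedCone φ

/-- The value of the left derived functor on an object on which `φ` is injective. -/
noncomputable def derivedConeSingleIso (hex : ∀ X, (evalObj φ ψ hφψ X).Exact)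
    (hψ : ∀ X, Epi (ψ.app X)) (X : A) (hX : Mono (φ.app X)) :
    (derivedCone φ).obj ((singleFunctor A 0).obj X) ≅ (singleFunctor B 0).obj (F.obj X) :=
  have := isIso_derivedConeCounit_app φ ψ hφψ
    ((HomologicalComplex.single A (ComplexShape.up ℤ) 0).obj X) (fun n => by
      refine shortExact_evalObj φ ψ hφψ _ (hex _) (hψ _) ?_
      by_cases hn : n = 0
      · subst hn
        exact mono_app_of_mono φ
          (HomologicalComplex.singleObjXSelf (ComplexShape.up ℤ) 0 X).hom inferInstance hX
      · have hz := HomologicalComplex.isZero_single_obj_X (ComplexShape.up ℤ) 0 X n hn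
        -- The zero object embeds in `X`, so the hypothesis on `X` also covers the degrees other
        -- than `0`.
        exact mono_app_of_mono φ (0 : _ ⟶ X) (hz.mono _) hX)
  (derivedCone φ).mapIso ((singleFunctorIsoCompQ A 0).app X) ≪≫
    @asIso _ _ _ _ ((derivedConeCounit φ ψ hφψ).app
      ((HomologicalComplex.single A (ComplexShape.up ℤ) 0).obj X)) this ≪≫
    Q.mapIso ((HomologicalComplex.singleMapHomologicalComplex F (ComplexShape.up ℤ) 0).app X) ≪≫
    ((singleFunctorIsoCompQ B 0).app (F.obj X)).symm

end

/-- The value on objects of the left derived functor of an exact functor. -/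
noncomputable def LeftDerived.onObjectIsoOfExact {F : A ⥤ B} [F.Additive] [PreservesFiniteLimits F]
    [PreservesFiniteColimits F] (LF : LeftDerived F) (X : A) :
    LF.onObject X ≅ (singleFunctor B 0).obj (F.obj X) :=
  (LF.totalIso (LeftDerived.ofExact F) (Iso.refl F)).app _ ≪≫
    (F.mapDerivedCategorySingleFunctor 0).app X

end

/-! ### Commutation relations between derived functors -/

section

open DerivedCategory DerivedCategory.TStructure

variable {A A' B B' : Type*} [Category* A] [Category* A'] [Category* B] [Category* B']
  [Abelian A] [Abelian A'] [Abelian B] [Abelian B']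
  [HasDerivedCategory A] [HasDerivedCategory A'] [HasDerivedCategory B] [HasDerivedCategory B']

/-- Derived cones commute with exact functors. -/
noncomputable def derivedConeCompIso {T₁ T₀ : A ⥤ B} [T₁.Additive] [T₀.Additive] (φ : T₁ ⟶ T₀)
    {T₁' T₀' : A' ⥤ B'} [T₁'.Additive] [T₀'.Additive] (φ' : T₁' ⟶ T₀')
    [PreservesFiniteLimits T₁] [PreservesFiniteColimits T₁]
    [PreservesFiniteLimits T₀] [PreservesFiniteColimits T₀]
    [PreservesFiniteLimits T₁'] [PreservesFiniteColimits T₁']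
    [PreservesFiniteLimits T₀'] [PreservesFiniteColimits T₀']
    (G : B ⥤ B') [G.Additive] (G' : A ⥤ A') [G'.Additive]
    [PreservesFiniteLimits G] [PreservesFiniteColimits G]
    [PreservesFiniteLimits G'] [PreservesFiniteColimits G']
    (e₁ : T₁ ⋙ G ≅ G' ⋙ T₁') (e₀ : T₀ ⋙ G ≅ G' ⋙ T₀')
    (comm : ∀ X, G.map (φ.app X) ≫ e₀.hom.app X = e₁.hom.app X ≫ φ'.app (G'.obj X)) :
    derivedCone φ ⋙ G.mapDerivedCategory ≅ G'.mapDerivedCategory ⋙ derivedCone φ' :=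
  letI e : Q ⋙ derivedCone φ ⋙ G.mapDerivedCategory ≅ Q ⋙ G'.mapDerivedCategory ⋙ derivedCone φ' :=
    (Functor.associator _ _ _).symm ≪≫
    Functor.isoWhiskerRight (derivedConeFactors φ) G.mapDerivedCategory ≪≫
    Functor.associator _ _ _ ≪≫
    Functor.isoWhiskerLeft (coneFunctor φ) G.mapDerivedCategoryFactors ≪≫
    (Functor.associator _ _ _).symm ≪≫
    Functor.isoWhiskerRight (coneFunctorCompIso φ φ' G G' e₁ e₀ comm) Q ≪≫
    Functor.associator _ _ _ ≪≫
    Functor.isoWhiskerLeft (G'.mapHomologicalComplex (ComplexShape.up ℤ))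
      (derivedConeFactors φ').symm ≪≫
    (Functor.associator _ _ _).symm ≪≫
    Functor.isoWhiskerRight G'.mapDerivedCategoryFactors.symm (derivedCone φ') ≪≫
    Functor.associator _ _ _
  Localization.liftNatIso Q (HomologicalComplex.quasiIso A (ComplexShape.up ℤ)) _ _ _ _ e

/-- Commutation relations between total left derived functors restrict to bounded derived
categories. -/
noncomputable def translationCompIso {F₁ : A ⥤ B} {F₂ : B ⥤ B'} {F₃ : A ⥤ A'} {F₄ : A' ⥤ B'}
    [F₁.Additive] [F₂.Additive] [F₃.Additive] [F₄.Additive]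
    (L₁ : LeftDerived F₁) (L₂ : LeftDerived F₂) (L₃ : LeftDerived F₃) (L₄ : LeftDerived F₄)
    (e : L₁.total ⋙ L₂.total ≅ L₃.total ⋙ L₄.total)
    (s : shiftFunctor _ (-1 : ℤ) ⋙ L₂.total ≅ L₂.total ⋙ shiftFunctor _ (-1 : ℤ)) :
    L₁.translation ⋙ L₂.onBounded ≅ L₃.onBounded ⋙ L₄.translation :=
  -- The bounded derived category is a full subcategory, so the isomorphism is built in the
  -- unbounded one; the shift `[-1]` is moved past `L₂` before `e` is applied.
  (t.bounded.fullyFaithfulι).whiskeringRight _ |>.preimageIso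
    (NatIso.ofComponents (fun X =>
      L₂.total.mapIso ((Bounded.ι.commShiftIso (-1 : ℤ)).app (L₁.onBounded.obj X)) ≪≫
      s.app _ ≪≫ (shiftFunctor _ (-1 : ℤ)).mapIso (e.app X.obj) ≪≫
      ((Bounded.ι.commShiftIso (-1 : ℤ)).app (L₄.onBounded.obj (L₃.onBounded.obj X))).symm) (by
      intro X Y f
      have h1 := congrArg L₂.total.map
        ((Bounded.ι.commShiftIso (-1 : ℤ)).hom.naturality (L₁.onBounded.map f))
      rw [Functor.map_comp, Functor.map_comp] at h1
      have h2 := s.hom.naturality (L₁.total.map f.hom)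
      have h3 := congrArg (shiftFunctor _ (-1 : ℤ)).map (e.hom.naturality f.hom)
      rw [Functor.map_comp, Functor.map_comp] at h3
      have h4 := (Bounded.ι.commShiftIso (-1 : ℤ)).inv.naturality
        (L₄.onBounded.map (L₃.onBounded.map f))
      exact ((CommSq.mk h1).vert_comp ((CommSq.mk h2).vert_comp
        ((CommSq.mk h3).vert_comp (CommSq.mk h4)))).w))

end

/-! ### Extensions by zero and restrictions -/

section

variable {k : Type u} [Field k] {J L : Type} [SmallCategory J] [SmallCategory L]

section

variable {ι : Type} (P : ι → L → Prop) (g : ι → L ⥤ J)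

open Classical in
/-- The transition maps of `extend`. -/
noncomputable def extendTransition (X : FDMod k J) {a b : L} (f : a ⟶ b) :
    ((q : {i // P i a}) → X.obj ((g q.1).obj a)) →ₗ[k]
      ((q : {i // P i b}) → X.obj ((g q.1).obj b)) where
  toFun φ q := if h : P q.1 a then X.map ((g q.1).map f) (φ ⟨q.1, h⟩) else 0
  map_add' φ ψ := by
    ext q; by_cases h : P q.1 a <;> simp [h]
  map_smul' c φ := by
    ext q; by_cases h : P q.1 a <;> simp [h]

lemma extendTransition_pos (X : FDMod k J) {a b : L} (f : a ⟶ b)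
    (φ : (q : {i // P i a}) → X.obj ((g q.1).obj a)) (q : {i // P i b}) (h : P q.1 a) :
    extendTransition P g X f φ q = X.map ((g q.1).map f) (φ ⟨q.1, h⟩) := dif_pos h

lemma extendTransition_neg (X : FDMod k J) {a b : L} (f : a ⟶ b)
    (φ : (q : {i // P i a}) → X.obj ((g q.1).obj a)) (q : {i // P i b}) (h : ¬ P q.1 a) :
    extendTransition P g X f φ q = 0 := dif_neg h

lemma extendTransition_id (X : FDMod k J) (a : L) :
    extendTransition P g X (𝟙 a) = LinearMap.id := by
  ext φ q
  rw [extendTransition_pos _ _ _ _ _ _ q.2, (g q.1).map_id, X.map_id]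
  rfl

/-- Upward closure of the support ensures that a coordinate alive at `a` and at `c` is not killed at
the intermediate vertex `b`. -/
lemma extendTransition_comp (hP : ∀ i {a b : L}, (a ⟶ b) → P i a → P i b) (X : FDMod k J)
    {a b c : L} (f : a ⟶ b) (f' : b ⟶ c) :
    extendTransition P g X (f ≫ f') = extendTransition P g X f' ∘ₗ extendTransition P g X f := by
  ext φ q
  rw [LinearMap.comp_apply]
  by_cases h : P q.1 a
  · rw [extendTransition_pos _ _ _ _ _ _ h, extendTransition_pos _ _ _ _ _ _ (hP _ f h),
      extendTransition_pos P g X f φ ⟨q.1, hP _ f h⟩ h, (g q.1).map_comp, X.map_comp]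
    rfl
  · rw [extendTransition_neg _ _ _ _ _ _ h]
    by_cases h' : P q.1 b
    · rw [extendTransition_pos _ _ _ _ _ _ h', extendTransition_neg P g X f φ ⟨q.1, h'⟩ h, map_zero]
    · rw [extendTransition_neg _ _ _ _ _ _ h']

lemma map_map_apply (X : FDMod k J) {a b c : J} (f : a ⟶ b) (f' : b ⟶ c) (x : X.obj a) :
    X.map f' (X.map f x) = X.map (f ≫ f') x := by
  rw [X.map_comp]
  rfl

/-- Each coordinate alive at `a` survives at `b`, where it is transported by an isomorphism and can
be recovered. -/
lemma injective_extendTransition (hP : ∀ i {a b : L}, (a ⟶ b) → P i a → P i b) (X : FDMod k J)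
    {a b : L} (f : a ⟶ b)
    (hf : ∀ i, P i a → IsIso ((g i).map f)) : Function.Injective (extendTransition P g X f) := by
  rw [← LinearMap.ker_eq_bot, LinearMap.ker_eq_bot']
  intro φ hφ
  funext q
  have := hf q.1 q.2
  have h1 := congrFun hφ ⟨q.1, hP _ f q.2⟩
  rw [extendTransition_pos P g X f φ ⟨q.1, hP _ f q.2⟩ q.2] at h1
  have h2 := congrArg (X.map (inv ((g q.1).map f))) h1
  rw [map_map_apply, IsIso.hom_inv_id, X.map_id] at h2
  exact h2.trans (map_zero _)

/-- The action of `extend` on morphisms. -/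
noncomputable def extendComponent {X Y : FDMod k J} (α : X ⟶ Y) (a : L) :
    ((q : {i // P i a}) → X.obj ((g q.1).obj a)) →ₗ[k]
      ((q : {i // P i a}) → Y.obj ((g q.1).obj a)) where
  toFun φ q := α.app ((g q.1).obj a) (φ q)
  map_add' φ ψ := by ext q; simp
  map_smul' c φ := by ext q; simp

lemma naturality_apply {X Y : FDMod k J} (α : X ⟶ Y) {a b : J} (f : a ⟶ b) (x : X.obj a) :
    α.app b (X.map f x) = Y.map f (α.app a x) :=
  ConcreteCategory.congr_hom (α.naturality f) x

lemma extendComponent_transition {X Y : FDMod k J} (α : X ⟶ Y) {a b : L} (f : a ⟶ b) :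
    extendComponent P g α b ∘ₗ extendTransition P g X f =
      extendTransition P g Y f ∘ₗ extendComponent P g α a := by
  ext φ q
  change α.app _ (extendTransition P g X f φ q) = extendTransition P g Y f _ q
  by_cases h : P q.1 a
  · rw [extendTransition_pos _ _ _ _ _ _ h, extendTransition_pos _ _ _ _ _ _ h]
    exact naturality_apply α _ _
  · rw [extendTransition_neg _ _ _ _ _ _ h, extendTransition_neg _ _ _ _ _ _ h, map_zero]

/-- The functor which sends `X` to the direct sum over `i` of the extensions by zero of
`l ↦ X (g i l)` from the upward closed set of the `l` such that `P i l`. -/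
noncomputable def extend [Finite ι] (hP : ∀ i {a b : L}, (a ⟶ b) → P i a → P i b) :
    FDMod k J ⥤ FDMod k L where
  obj X :=
    { obj := fun l => FGModuleCat.of k ((q : {i // P i l}) → X.obj ((g q.1).obj l))
      map := fun f => FGModuleCat.ofHom (extendTransition P g X f)
      map_id := fun a => congrArg FGModuleCat.ofHom (extendTransition_id P g X a)
      map_comp := fun f f' => congrArg FGModuleCat.ofHom (extendTransition_comp P g hP X f f') }
  map α :=
    { app := fun l => FGModuleCat.ofHom (extendComponent P g α l)
      naturality := fun _ _ f =>
        congrArg FGModuleCat.ofHom (extendComponent_transition P g α f) }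

instance [Finite ι] (hP : ∀ i {a b : L}, (a ⟶ b) → P i a → P i b) :
    (extend (k := k) P g hP).Additive where
  map_add := by
    intros
    rfl

/-- For a single index, the components of `extend` are components of the given module. -/
noncomputable def extendEvalIso [Unique ι] (hP : ∀ i {a b : L}, (a ⟶ b) → P i a → P i b) (l : L)
    (hl : P default l) :
    extend (k := k) P g hP ⋙ (evaluation _ _).obj l ≅ (evaluation _ _).obj ((g default).obj l) :=
  NatIso.ofComponents (fun X =>
    { hom := FGModuleCat.ofHom
        { toFun := fun φ => φ ⟨default, hl⟩
          map_add' := fun _ _ => rfl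
          map_smul' := fun _ _ => rfl }
      inv := FGModuleCat.ofHom
        { toFun := fun x q => (congrArg (fun i => (X.obj ((g i).obj l) : Type u))
            (Subsingleton.elim default q.1)).mp x
          map_add' := by
            intro x y; funext ⟨q, hq⟩; obtain rfl := Subsingleton.elim default q; rfl
          map_smul' := by
            intro c x; funext ⟨q, hq⟩; obtain rfl := Subsingleton.elim default q; rfl }
      hom_inv_id := by
        apply ConcreteCategory.hom_ext
        intro φ
        funext ⟨q, hq⟩
        obtain rfl := Subsingleton.elim default q
        rfl
      inv_hom_id := rfl }) (fun _ => rfl)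

lemma isZero_extend_eval [Unique ι] (hP : ∀ i {a b : L}, (a ⟶ b) → P i a → P i b) (l : L)
    (hl : ¬ P default l) : IsZero (extend (k := k) P g hP ⋙ (evaluation _ _).obj l) := by
  rw [Functor.isZero_iff]
  intro X
  rw [IsZero.iff_id_eq_zero]
  apply ConcreteCategory.hom_ext
  intro φ
  funext ⟨q, hq⟩
  obtain rfl := Subsingleton.elim default q
  exact (hl hq).elim

/-- Exactness is tested on components: each is either evaluation at a vertex or zero. Only the
single-index case is needed, for `belowFunctor`. -/
instance preservesFiniteLimits_extend [Unique ι]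
    (hP : ∀ i {a b : L}, (a ⟶ b) → P i a → P i b) :
    PreservesFiniteLimits (extend (k := k) P g hP) := by
  apply preservesFiniteLimits_of_evaluation
  intro l
  by_cases hl : P default l
  · exact preservesFiniteLimits_of_natIso (extendEvalIso P g hP l hl).symm
  · exact ⟨fun _ _ _ => Functor.preservesLimitsOfShape_of_isZero _ (isZero_extend_eval P g hP l hl) _⟩

instance preservesFiniteColimits_extend [Unique ι]
    (hP : ∀ i {a b : L}, (a ⟶ b) → P i a → P i b) :
    PreservesFiniteColimits (extend (k := k) P g hP) := by
  apply preservesFiniteColimits_of_evaluation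
  intro l
  by_cases hl : P default l
  · exact preservesFiniteColimits_of_natIso (extendEvalIso P g hP l hl).symm
  · exact ⟨fun _ _ _ => Functor.preservesColimitsOfShape_of_isZero _ (isZero_extend_eval P g hP l hl) _⟩

end

/-- Restriction along a functor. -/
abbrev precomp (k : Type u) [Field k] (h : L ⥤ J) : FDMod k J ⥤ FDMod k L :=
  (Functor.whiskeringLeft L J (FGModuleCat.{u} k)).obj h

instance (h : L ⥤ J) : PreservesFiniteLimits (precomp k h) := by
  apply preservesFiniteLimits_of_evaluation
  intro l
  exact inferInstanceAs (PreservesFiniteLimits ((evaluation J (FGModuleCat.{u} k)).obj (h.obj l)))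

instance (h : L ⥤ J) : PreservesFiniteColimits (precomp k h) := by
  apply preservesFiniteColimits_of_evaluation
  intro l
  exact inferInstanceAs (PreservesFiniteColimits ((evaluation J (FGModuleCat.{u} k)).obj (h.obj l)))

section

variable {ι : Type} [Fintype ι] (P : ι → L → Prop) (g : ι → L ⥤ J)
  (hP : ∀ i {a b : L}, (a ⟶ b) → P i a → P i b) (h : L ⥤ J)
  (t : ∀ i l, P i l → ((g i).obj l ⟶ h.obj l))

open Classical in
/-- The components of `extendDesc`. -/
noncomputable def extendDescComponent (X : FDMod k J) (l : L) :
    ((q : {i // P i l}) → X.obj ((g q.1).obj l)) →ₗ[k] X.obj (h.obj l) :=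
  ∑ i : ι, if hi : P i l then (X.map (t i l hi)).hom.hom ∘ₗ
    LinearMap.proj (R := k) (φ := fun q : {i // P i l} => X.obj ((g q.1).obj l)) ⟨i, hi⟩ else 0

open Classical in
lemma extendDescComponent_apply (X : FDMod k J) (l : L)
    (φ : (q : {i // P i l}) → X.obj ((g q.1).obj l)) :
    extendDescComponent P g h t X l φ =
      ∑ i : ι, if hi : P i l then X.map (t i l hi) (φ ⟨i, hi⟩) else 0 := by
  simp only [extendDescComponent, LinearMap.sum_apply]
  refine Finset.sum_congr rfl fun i _ => ?_
  by_cases hi : P i l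
  · simp only [dif_pos hi]
    rfl
  · simp only [dif_neg hi]
    rfl

include hP in
-- Summand by summand both sides apply `X` to parallel arrows, which coincide as `J` is thin; a
-- summand not alive at `a` contributes zero to both.
lemma extendDescComponent_transition [Quiver.IsThin J] (X : FDMod k J) {a b : L} (f : a ⟶ b) :
    extendDescComponent P g h t X b ∘ₗ extendTransition P g X f =
      (X.map (h.map f)).hom.hom ∘ₗ extendDescComponent P g h t X a := by
  classical
  refine LinearMap.ext fun φ => ?_
  change extendDescComponent P g h t X b (extendTransition P g X f φ) =
    X.map (h.map f) (extendDescComponent P g h t X a φ)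
  rw [extendDescComponent_apply, extendDescComponent_apply, map_sum]
  refine Finset.sum_congr rfl fun i _ => ?_
  by_cases hi : P i a
  · rw [dif_pos hi, dif_pos (hP i f hi), extendTransition_pos P g X f φ ⟨i, hP i f hi⟩ hi,
      map_map_apply, map_map_apply]
    congr 2
    exact congrArg X.map (Subsingleton.elim _ _)
  · rw [dif_neg hi, map_zero]
    by_cases hi' : P i b
    · rw [dif_pos hi', extendTransition_neg P g X f φ ⟨i, hi'⟩ hi, map_zero]
    · rw [dif_neg hi']

lemma extendDescComponent_component {X Y : FDMod k J} (α : X ⟶ Y) (l : L) :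
    extendDescComponent P g h t Y l ∘ₗ extendComponent P g α l =
      (α.app (h.obj l)).hom.hom ∘ₗ extendDescComponent P g h t X l := by
  classical
  refine LinearMap.ext fun φ => ?_
  change extendDescComponent P g h t Y l (extendComponent P g α l φ) =
    α.app (h.obj l) (extendDescComponent P g h t X l φ)
  rw [extendDescComponent_apply, extendDescComponent_apply, map_sum]
  refine Finset.sum_congr rfl fun i _ => ?_
  by_cases hi : P i l
  · rw [dif_pos hi, dif_pos hi]
    exact (naturality_apply α _ _).symm
  · rw [dif_neg hi, dif_neg hi, map_zero]

/-- The sum of the maps from the components to a restriction. -/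
noncomputable def extendDesc [Quiver.IsThin J] : extend (k := k) P g hP ⟶ precomp k h where
  app X :=
    { app := fun l => FGModuleCat.ofHom (extendDescComponent P g h t X l)
      naturality := fun _ _ f =>
        congrArg FGModuleCat.ofHom (extendDescComponent_transition P g hP h t X f) }
  naturality X Y α := by
    ext1
    funext l
    exact congrArg FGModuleCat.ofHom (extendDescComponent_component P g h t α l)

/-- If a point is itself one of the components, then it is hit by `extendDesc`. -/
lemma surjective_extendDescComponent (X : FDMod k J) (l : L) (i : ι) (hi : P i l)
    (ht : IsIso (t i l hi)) : Function.Surjective (extendDescComponent P g h t X l) := by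
  classical
  intro x
  refine ⟨Pi.single ⟨i, hi⟩ (X.map (inv (t i l hi)) x), ?_⟩
  rw [extendDescComponent_apply, Finset.sum_eq_single i]
  · rw [dif_pos hi, Pi.single_eq_same, map_map_apply, IsIso.inv_hom_id, X.map_id]
    rfl
  · intro j _ hj
    by_cases hj' : P j l
    · rw [dif_pos hj', Pi.single_eq_of_ne, map_zero]
      exact fun h => hj (congrArg Subtype.val h)
    · rw [dif_neg hj']
  · intro hi'
    exact (hi' (Finset.mem_univ _)).elim

end

end
-- Generators and relations of tensor products
section

variable {k : Type u} [Field k]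

/-- Generators of a module whose components are one-dimensional on `T` and zero elsewhere,
and which are preserved by the transition maps between points of `T`. -/
structure StandardGen {I : Type} [SmallCategory I] (B : FDMod k I) (T : Set I) where
  u (x : I) : 𝟙_ (FGModuleCat.{u} k) ⟶ B.obj x
  e (x : I) : B.obj x ⟶ 𝟙_ (FGModuleCat.{u} k)
  e_u (x : I) : e x ≫ u x = 𝟙 _
  u_e {x : I} (hx : x ∈ T) : u x ≫ e x = 𝟙 _
  u_zero {x : I} (hx : x ∉ T) : u x = 0
  u_map {x y : I} (f : x ⟶ y) (hx : x ∈ T) : u x ≫ B.map f = u y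

lemma StandardGen.whiskerLeft_cancel {I : Type} [SmallCategory I] {B : FDMod k I} {T : Set I}
    (G : StandardGen B T) (Y : FGModuleCat.{u} k) {Z : FGModuleCat.{u} k} (x : I)
    {α β : Y ⊗ B.obj x ⟶ Z} (h : Y ◁ G.u x ≫ α = Y ◁ G.u x ≫ β) : α = β := by
  have h' := congrArg (Y ◁ G.e x ≫ ·) h
  rwa [← MonoidalCategory.whiskerLeft_comp_assoc, ← MonoidalCategory.whiskerLeft_comp_assoc,
    G.e_u, MonoidalCategory.whiskerLeft_id, Category.id_comp, Category.id_comp] at h'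

variable {C D J L : Type} [SmallCategory C] [SmallCategory D] [SmallCategory J] [SmallCategory L]
  [FinCategory C] (s : C × L ⥤ J) (r : L ⥤ D) (B : FDMod k (Cᵒᵖ × D))

/-- The canonical map to a component of a tensor product. -/
noncomputable def tensorπ (X : FDMod k J) (l : L) (c : C) :
    X.obj (s.obj (c, l)) ⊗ B.obj (op c, r.obj l) ⟶ ((tensor s r B).obj X).obj l :=
  coend.ι ((tensorIntegrand s r B X).obj l) c

lemma tensorπ_condition (X : FDMod k J) (l : L) {c c' : C} (f : c ⟶ c') :
    X.obj (s.obj (c, l)) ◁ B.map (Prod.mkHom f.op (𝟙 (r.obj l))) ≫ tensorπ s r B X l c =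
      X.map (s.map (Prod.mkHom f (𝟙 l))) ▷ B.obj (op c', r.obj l) ≫ tensorπ s r B X l c' :=
  coend.condition ((tensorIntegrand s r B X).obj l) f

lemma tensorπ_map (X : FDMod k J) {l l' : L} (f : l ⟶ l') (c : C) :
    tensorπ s r B X l c ≫ ((tensor s r B).obj X).map f =
      (X.map (s.map (Prod.mkHom (𝟙 c) f)) ⊗ₘ B.map (Prod.mkHom (𝟙 (op c)) (r.map f))) ≫
        tensorπ s r B X l' c :=
  coend.ι_map ((tensorIntegrand s r B X).map f) c

lemma tensorπ_naturality {X Y : FDMod k J} (α : X ⟶ Y) (l : L) (c : C) :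
    tensorπ s r B X l c ≫ ((tensor s r B).map α).app l =
      α.app (s.obj (c, l)) ▷ B.obj (op c, r.obj l) ≫ tensorπ s r B Y l c :=
  coend.ι_map ((tensorIntegrandMap s r B α).app l) c

lemma tensorπ_hom_ext (X : FDMod k J) (l : L) {Z : FGModuleCat.{u} k}
    {α β : ((tensor s r B).obj X).obj l ⟶ Z}
    (h : ∀ c, tensorπ s r B X l c ≫ α = tensorπ s r B X l c ≫ β) : α = β :=
  coend.hom_ext h

lemma exists_tensorπ_desc (X : FDMod k J) (l : L) {Z : FGModuleCat.{u} k}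
    (β : ∀ c, X.obj (s.obj (c, l)) ⊗ B.obj (op c, r.obj l) ⟶ Z)
    (hβ : ∀ {c c' : C} (f : c ⟶ c'),
      X.obj (s.obj (c, l)) ◁ B.map (Prod.mkHom f.op (𝟙 (r.obj l))) ≫ β c =
        X.map (s.map (Prod.mkHom f (𝟙 l))) ▷ B.obj (op c', r.obj l) ≫ β c') :
    ∃ γ : ((tensor s r B).obj X).obj l ⟶ Z, ∀ c, tensorπ s r B X l c ≫ γ = β c :=
  ⟨coend.desc (F := (tensorIntegrand s r B X).obj l) β (fun _ _ f => hβ f),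
    fun c => coend.ι_desc (F := (tensorIntegrand s r B X).obj l) β (fun _ _ f => hβ f) c⟩

/-- The map `x ↦ x ⊗ v` to a tensor product. -/
noncomputable def tensorι (X : FDMod k J) (l : L) (c : C)
    (v : 𝟙_ (FGModuleCat.{u} k) ⟶ B.obj (op c, r.obj l)) :
    X.obj (s.obj (c, l)) ⟶ ((tensor s r B).obj X).obj l :=
  (ρ_ (X.obj (s.obj (c, l)))).inv ≫ X.obj (s.obj (c, l)) ◁ v ≫ tensorπ s r B X l c

lemma tensorι_zero (X : FDMod k J) (l : L) (c : C) : tensorι s r B X l c 0 = 0 := by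
  rw [tensorι, MonoidalPreadditive.whiskerLeft_zero, zero_comp, comp_zero]

/-- The defining relation `x f ⊗ v = x ⊗ f v`, for generators. -/
lemma tensorι_slide (X : FDMod k J) (l : L) {c c' : C} (f : c ⟶ c')
    (v : 𝟙_ (FGModuleCat.{u} k) ⟶ B.obj (op c', r.obj l)) :
    X.map (s.map (Prod.mkHom f (𝟙 l))) ≫ tensorι s r B X l c' v =
      tensorι s r B X l c (v ≫ B.map (Prod.mkHom f.op (𝟙 (r.obj l)))) := by
  rw [tensorι, tensorι, rightUnitor_inv_naturality_assoc, ← whisker_exchange_assoc,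
    MonoidalCategory.whiskerLeft_comp_assoc, tensorπ_condition]

lemma tensorι_map (X : FDMod k J) {l l' : L} (f : l ⟶ l') (c : C)
    (v : 𝟙_ (FGModuleCat.{u} k) ⟶ B.obj (op c, r.obj l)) :
    tensorι s r B X l c v ≫ ((tensor s r B).obj X).map f =
      X.map (s.map (Prod.mkHom (𝟙 c) f)) ≫
        tensorι s r B X l' c (v ≫ B.map (Prod.mkHom (𝟙 (op c)) (r.map f))) := by
  rw [tensorι, tensorι, Category.assoc, Category.assoc, tensorπ_map, MonoidalCategory.tensorHom_def,
    Category.assoc, rightUnitor_inv_naturality_assoc, whisker_exchange_assoc,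
    MonoidalCategory.whiskerLeft_comp_assoc]

lemma tensorι_naturality {X Y : FDMod k J} (α : X ⟶ Y) (l : L) (c : C)
    (v : 𝟙_ (FGModuleCat.{u} k) ⟶ B.obj (op c, r.obj l)) :
    tensorι s r B X l c v ≫ ((tensor s r B).map α).app l =
      α.app (s.obj (c, l)) ≫ tensorι s r B Y l c v := by
  rw [tensorι, tensorι, Category.assoc, Category.assoc, tensorπ_naturality,
    rightUnitor_inv_naturality_assoc, whisker_exchange_assoc]

variable {B} {T : Set (Cᵒᵖ × D)} (G : StandardGen B T)

include G in
-- The components of `B` vanish off `T` and are spanned by `u` on `T`, so the elements `x ⊗ u` over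
-- `T` generate.
lemma tensor_hom_ext (X : FDMod k J) (l : L) {Z : FGModuleCat.{u} k}
    {α β : ((tensor s r B).obj X).obj l ⟶ Z}
    (h : ∀ c, (op c, r.obj l) ∈ T →
      tensorι s r B X l c (G.u (op c, r.obj l)) ≫ α = tensorι s r B X l c (G.u _) ≫ β) :
    α = β := by
  apply tensorπ_hom_ext
  intro c
  apply G.whiskerLeft_cancel
  by_cases hc : (op c, r.obj l) ∈ T
  · rw [← cancel_epi (ρ_ (X.obj (s.obj (c, l)))).inv]
    simpa only [tensorι, Category.assoc] using h c hc
  · rw [G.u_zero hc, MonoidalPreadditive.whiskerLeft_zero, zero_comp, zero_comp]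

include G in
-- An arrow `c → c'` gives a relation on `X(c) ⊗ B(c')`, empty unless `c'` lies over `T`. It
-- identifies two generators if `c` lies over `T` too, and otherwise kills the image of `X(c)`.
lemma exists_tensor_desc (X : FDMod k J) (l : L) {Z : FGModuleCat.{u} k}
    (β : ∀ c, X.obj (s.obj (c, l)) ⟶ Z)
    (h₁ : ∀ {c c' : C} (f : c ⟶ c'), (op c, r.obj l) ∈ T → (op c', r.obj l) ∈ T →
      X.map (s.map (Prod.mkHom f (𝟙 l))) ≫ β c' = β c)
    (h₀ : ∀ {c c' : C} (f : c ⟶ c'), (op c, r.obj l) ∉ T → (op c', r.obj l) ∈ T →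
      X.map (s.map (Prod.mkHom f (𝟙 l))) ≫ β c' = 0) :
    ∃ γ : ((tensor s r B).obj X).obj l ⟶ Z, ∀ c, (op c, r.obj l) ∈ T →
      tensorι s r B X l c (G.u (op c, r.obj l)) ≫ γ = β c := by
  obtain ⟨γ, hγ⟩ := exists_tensorπ_desc s r B X l
    (fun c => X.obj (s.obj (c, l)) ◁ G.e (op c, r.obj l) ≫ (ρ_ _).hom ≫ β c) (by
      intro c c' f
      apply G.whiskerLeft_cancel
      by_cases hc' : (op c', r.obj l) ∈ T
      · rw [whisker_exchange_assoc, ← MonoidalCategory.whiskerLeft_comp_assoc,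
          ← MonoidalCategory.whiskerLeft_comp_assoc, ← MonoidalCategory.whiskerLeft_comp_assoc,
          G.u_map _ hc', G.u_e hc', MonoidalCategory.whiskerLeft_id, Category.id_comp,
          rightUnitor_naturality_assoc]
        by_cases hc : (op c, r.obj l) ∈ T
        · rw [G.u_e hc, h₁ f hc hc', MonoidalCategory.whiskerLeft_id, Category.id_comp]
        · rw [G.u_zero hc, h₀ f hc hc', zero_comp, MonoidalPreadditive.whiskerLeft_zero,
            zero_comp, comp_zero]
      · rw [G.u_zero hc', MonoidalPreadditive.whiskerLeft_zero, zero_comp, zero_comp])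
  refine ⟨γ, fun c hc => ?_⟩
  rw [tensorι, Category.assoc, Category.assoc, hγ, ← MonoidalCategory.whiskerLeft_comp_assoc,
    G.u_e hc, MonoidalCategory.whiskerLeft_id, Category.id_comp, Iso.inv_hom_id_assoc]

end

/-! ### Tensor products with modules supported on intervals -/

/-- The functor `b ↦ max 1 (b - 1)`. -/
def predVertex (p : ℕ) : Vertex p ⥤ Vertex p where
  obj b := ⟨max 1 (b.1 - 1), by have := b.2; rw [Set.mem_Icc] at this ⊢; omega⟩
  map {b c} f := homOfLE (by
    have : b.1 ≤ c.1 := Subtype.coe_le_coe.2 (leOfHom f)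
    exact Subtype.coe_le_coe.1 (by dsimp; omega))

section

variable {k : Type u} [Field k] {p : ℕ} {D J L : Type} [SmallCategory D] [SmallCategory J]
  [SmallCategory L] (s : Vertex p × L ⥤ J)

/-- Restriction of the first argument of `s` to the graph of a functor. -/
abbrev graphComp (σ : L ⥤ Vertex p) : L ⥤ J := σ.prod' (𝟭 L) ⋙ s

lemma upward_one_lt (lo : L ⥤ Vertex p) (_ : Unit) {a b : L} (f : a ⟶ b) (h : 1 < (lo.obj a).1) :
    1 < (lo.obj b).1 :=
  lt_of_lt_of_le h (Subtype.coe_le_coe.2 (leOfHom (lo.map f)))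

/-- The functor `X ↦ (l ↦ X (s (lo l - 1, l)))`, where `X (s (0, l))` is understood as zero. -/
noncomputable abbrev belowFunctor (k : Type u) [Field k] (lo : L ⥤ Vertex p) :
    FDMod k J ⥤ FDMod k L :=
  extend (ι := Unit) (fun _ l => 1 < (lo.obj l).1) (fun _ => graphComp s (lo ⋙ predVertex p))
    (upward_one_lt lo)

/-- The functor `X ↦ (l ↦ X (s (hi l, l)))`. -/
noncomputable abbrev topFunctor (k : Type u) [Field k] (hi : L ⥤ Vertex p) :
    FDMod k J ⥤ FDMod k L :=
  precomp k (graphComp s hi)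

variable (lo hi : L ⥤ Vertex p) (hle : ∀ l, lo.obj l ≤ hi.obj l)

include hle in
lemma pred_le (l : L) : (predVertex p).obj (lo.obj l) ≤ hi.obj l := by
  refine le_trans ?_ (hle l)
  have := (lo.obj l).2
  rw [Set.mem_Icc] at this
  exact Subtype.coe_le_coe.1 (by dsimp [predVertex]; omega)

/-- The transition map from `belowFunctor` to `topFunctor`. -/
noncomputable def belowToTop (k : Type u) [Field k] [Quiver.IsThin J] :
    belowFunctor s k lo ⟶ topFunctor s k hi :=
  extendDesc _ _ (upward_one_lt lo) _
    (fun _ l _ => s.map (Prod.mkHom (homOfLE (pred_le lo hi hle l)) (𝟙 l)))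

lemma belowToTop_apply [Quiver.IsThin J] (X : FDMod k J) (l : L) (hl : 1 < (lo.obj l).1)
    (φ : ((belowFunctor s k lo).obj X).obj l) :
    ((belowToTop s lo hi hle k).app X).app l φ =
      X.map (s.map (Prod.mkHom (homOfLE (pred_le lo hi hle l)) (𝟙 l))) (φ ⟨(), hl⟩) := by
  refine (extendDescComponent_apply _ _ _ _ _ _ _).trans ?_
  rw [Fintype.sum_unique]
  exact dif_pos hl

lemma subsingleton_below (X : FDMod k J) (l : L) (hl : ¬ 1 < (lo.obj l).1) :
    Subsingleton (((belowFunctor s k lo).obj X).obj l) :=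
  ⟨fun _ _ => funext fun q => (hl q.2).elim⟩

variable (r : L ⥤ D) {B : FDMod k ((Vertex p)ᵒᵖ × D)} {T : Set ((Vertex p)ᵒᵖ × D)}
  (G : StandardGen B T)
  (hT : ∀ c l, (op c, r.obj l) ∈ T ↔ lo.obj l ≤ c ∧ c ≤ hi.obj l)

include hT hle in
lemma hi_mem (l : L) : (op (hi.obj l), r.obj l) ∈ T := (hT _ _).2 ⟨hle l, le_rfl⟩

/-- The components of `topToTensor`. -/
noncomputable def topToTensorApp (X : FDMod k J) (l : L) :
    X.obj (s.obj (hi.obj l, l)) ⟶ ((tensor s r B).obj X).obj l :=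
  tensorι s r B X l (hi.obj l) (G.u (op (hi.obj l), r.obj l))

include hT in
-- Generators slide up to the vertex `hi l`. For `c` in the interval this gives surjectivity of
-- `topToTensor`; for `c` below it the right-hand side vanishes, which gives the relations.
lemma map_topToTensorApp (X : FDMod k J) (l : L) (c : Vertex p) (f : c ⟶ hi.obj l)
    (hle : lo.obj l ≤ hi.obj l) :
    X.map (s.map (Prod.mkHom f (𝟙 l))) ≫ topToTensorApp s hi r G X l =
      tensorι s r B X l c (G.u (op c, r.obj l)) := by
  rw [topToTensorApp, tensorι_slide, G.u_map _ ((hT _ _).2 ⟨hle, le_rfl⟩)]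

/-- The quotient map onto the tensor product with a standard module, the support of which is
given by intervals. -/
noncomputable def topToTensor : topFunctor s k hi ⟶ tensor s r B where
  app X :=
    { app := topToTensorApp s hi r G X
      naturality := fun l l' f => by
        have h1 : ((topFunctor s k hi).obj X).map f =
            X.map (s.map (Prod.mkHom (𝟙 _) f)) ≫ X.map (s.map (Prod.mkHom (hi.map f) (𝟙 l'))) := by
          rw [← X.map_comp, ← s.map_comp, prod_comp, Category.comp_id, Category.id_comp]
          rfl
        rw [h1, Category.assoc, map_topToTensorApp s lo hi r G hT _ _ _ _ (hle _), topToTensorApp,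
          tensorι_map, G.u_map _ (hi_mem lo hi hle r hT l)] }
  naturality X Y α := by
    ext1
    funext l
    exact (tensorι_naturality s r B α l _ _).symm

lemma epi_topToTensor_app (X : FDMod k J) : Epi ((topToTensor s lo hi hle r G hT).app X) := by
  have h : ∀ l, Epi (((topToTensor s lo hi hle r G hT).app X).app l) := by
    intro l
    constructor
    intro Z α β h
    apply tensor_hom_ext s r G
    intro c hc
    rw [← map_topToTensorApp s lo hi r G hT X l c (homOfLE ((hT _ _).1 hc).2) (hle l),
      Category.assoc, Category.assoc]
    exact congrArg (_ ≫ ·) h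
  exact NatTrans.epi_of_epi_app _

/-- Sliding back to `lo l - 1`, just outside the support, meets the generator `u = 0`; if `lo l = 1`
the source is already zero. -/
lemma belowToTop_comp_topToTensor [Quiver.IsThin J] :
    belowToTop s lo hi hle k ≫ topToTensor s lo hi hle r G hT = 0 := by
  ext1
  funext X
  ext1
  funext l
  apply ConcreteCategory.hom_ext
  intro φ
  by_cases hl : 1 < (lo.obj l).1
  · have h : X.map (s.map (Prod.mkHom (homOfLE (pred_le lo hi hle l)) (𝟙 l))) ≫
        topToTensorApp s hi r G X l = 0 := by
      rw [map_topToTensorApp s lo hi r G hT X l _ _ (hle l), G.u_zero, tensorι_zero]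
      rw [hT]
      intro h
      have h1 := Subtype.coe_le_coe.2 h.1
      dsimp [predVertex] at h1
      omega
    change topToTensorApp s hi r G X l (((belowToTop s lo hi hle k).app X).app l φ) = 0
    rw [belowToTop_apply s lo hi hle X l hl]
    exact ConcreteCategory.congr_hom h _
  · have := subsingleton_below s lo X l hl
    rw [Subsingleton.elim φ 0, map_zero, map_zero]

include G hT in
-- No further relations hold in the tensor product: since the projection to the cokernel factors
-- through it, an element of `X(hi l)` killed by tensoring comes from `X(lo l - 1)`.
lemma exists_tensor_desc_cokernel [Quiver.IsThin J] (X : FDMod k J) (l : L) :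
    ∃ γ : ((tensor s r B).obj X).obj l ⟶ cokernel (((belowToTop s lo hi hle k).app X).app l),
      topToTensorApp s hi r G X l ≫ γ = cokernel.π (((belowToTop s lo hi hle k).app X).app l) := by
  classical
  let π := cokernel.π (((belowToTop s lo hi hle k).app X).app l)
  obtain ⟨γ, hγ⟩ := exists_tensor_desc s r G X l (Z := cokernel _)
    (fun c => if h : c ≤ hi.obj l then X.map (s.map (Prod.mkHom (homOfLE h) (𝟙 l))) ≫ π else 0)
    (by
      intro c c' f hc hc'
      rw [dif_pos ((hT _ _).1 hc).2, dif_pos ((hT _ _).1 hc').2, ← Category.assoc, ← X.map_comp,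
        ← s.map_comp, prod_comp, Category.comp_id]
      rfl)
    (by
      intro c c' f hc hc'
      -- Since `c ≤ c' ≤ hi l`, the vertex `c` can only leave the interval from below, so its arrow
      -- to `hi l` factors through `lo l - 1`.
      have hlt : c < lo.obj l := by
        by_contra hcon
        exact hc ((hT _ _).2 ⟨not_lt.1 hcon, (leOfHom f).trans ((hT _ _).1 hc').2⟩)
      have hlt' : c.1 < (lo.obj l).1 := Subtype.coe_lt_coe.2 hlt
      have hc1 : 1 ≤ c.1 := c.2.1
      have hpos : 1 < (lo.obj l).1 := by omega
      have hcp : c ≤ (predVertex p).obj (lo.obj l) :=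
        Subtype.coe_le_coe.1 (by dsimp [predVertex]; omega)
      have h0 : X.map (s.map (Prod.mkHom (homOfLE (pred_le lo hi hle l)) (𝟙 l))) ≫ π = 0 := by
        apply ConcreteCategory.hom_ext
        intro x
        have h := ConcreteCategory.congr_hom
          (cokernel.condition (((belowToTop s lo hi hle k).app X).app l)) (fun _ => x)
        refine Eq.trans ?_ h
        exact (congrArg π (belowToTop_apply s lo hi hle X l hpos (fun _ => x))).symm
      rw [dif_pos ((hT _ _).1 hc').2, ← Category.assoc, ← X.map_comp, ← s.map_comp, prod_comp,
        Category.comp_id]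
      have h2 : s.map (Prod.mkHom (f ≫ homOfLE ((hT _ _).1 hc').2) (𝟙 l)) =
          s.map (Prod.mkHom (homOfLE hcp) (𝟙 l)) ≫
            s.map (Prod.mkHom (homOfLE (pred_le lo hi hle l)) (𝟙 l)) := Subsingleton.elim _ _
      rw [h2, X.map_comp, Category.assoc, h0, comp_zero])
  refine ⟨γ, (hγ _ (hi_mem lo hi hle r hT l)).trans ?_⟩
  rw [dif_pos le_rfl]
  have h3 : s.map (Prod.mkHom (homOfLE le_rfl) (𝟙 l)) = 𝟙 (s.obj (hi.obj l, l)) :=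
    Subsingleton.elim _ _
  rw [h3, X.map_id, Category.id_comp]

/-- The tensor product with a standard module, the support of which is given by intervals, is
a cokernel of exact functors. -/
lemma exact_belowToTop_topToTensor [Quiver.IsThin J] (X : FDMod k J) :
    (evalObj (belowToTop s lo hi hle k) (topToTensor s lo hi hle r G hT)
      (belowToTop_comp_topToTensor s lo hi hle r G hT) X).Exact := by
  rw [ShortComplex.exact_iff_isZero_homology, Functor.isZero_iff]
  intro l
  let S := evalObj (belowToTop s lo hi hle k) (topToTensor s lo hi hle r G hT)
      (belowToTop_comp_topToTensor s lo hi hle r G hT) X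
  refine IsZero.of_iso ?_ (S.mapHomologyIso ((evaluation L (FGModuleCat.{u} k)).obj l)).symm
  rw [← ShortComplex.exact_iff_isZero_homology]
  obtain ⟨γ, hγ⟩ := exists_tensor_desc_cokernel s lo hi hle r G hT X l
  have hcok := ShortComplex.exact_cokernel (((belowToTop s lo hi hle k).app X).app l)
  rw [ShortComplex.exact_iff_exact_up_to_refinements] at hcok ⊢
  intro A x hx
  -- What dies in the tensor product dies in the cokernel through `γ`, so it lifts.
  exact hcok x ((congrArg (x ≫ ·) hγ.symm).trans ((Category.assoc x _ γ).symm.trans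
    ((congrArg (· ≫ γ) hx).trans zero_comp)))

end

lemma isIso_of_thin {I : Type} [SmallCategory I] [Quiver.IsThin I] {a b : I} (f : a ⟶ b)
    (g : b ⟶ a) : IsIso f :=
  ⟨g, Subsingleton.elim _ _, Subsingleton.elim _ _⟩

/-! ### Free resolutions in one direction -/

section

variable {k : Type u} [Field k] {p : ℕ} {J : Type} [SmallCategory J]
  (s : Vertex p × J ⥤ J) (r : J ⥤ Vertex p)

/-- The functor `X ↦ (j ↦ ⨁_{c ≤ r j} X (s (c, j)))`, a resolution in the direction of `s`. -/
noncomputable abbrev freeFunctor (k : Type u) [Field k] : FDMod k J ⥤ FDMod k J :=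
  extend (ι := Vertex p) (fun c j => c ≤ r.obj j)
    (fun c => graphComp s ((Functor.const J).obj c)) (fun _ _ _ f h => h.trans (leOfHom (r.map f)))

variable (hsr : ∀ j, s.obj (r.obj j, j) = j)

/-- The structure map of the resolution. -/
noncomputable def freeDesc (k : Type u) [Field k] [Quiver.IsThin J] :
    freeFunctor s r k ⟶ 𝟭 (FDMod k J) :=
  extendDesc (ι := Vertex p) (fun c j => c ≤ r.obj j)
    (fun c => graphComp s ((Functor.const J).obj c)) (fun _ _ _ f h => h.trans (leOfHom (r.map f)))
    (𝟭 J) (fun _ j h => s.map (Prod.mkHom (homOfLE h) (𝟙 j)) ≫ eqToHom (hsr j))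

/-- The summand of index `c = r j` is `X(j)` itself. -/
lemma epi_freeDesc_app [Quiver.IsThin J] (X : FDMod k J) : Epi ((freeDesc s r hsr k).app X) := by
  have h : ∀ j, Epi (((freeDesc s r hsr k).app X).app j) := by
    intro j
    apply ConcreteCategory.epi_of_surjective
    exact surjective_extendDescComponent _ _ (𝟭 J) _ X j (r.obj j) le_rfl
      (isIso_of_thin _ (eqToHom (hsr j).symm))
  exact NatTrans.epi_of_epi_app _

lemma mono_belowToTop_app_of_injective [Quiver.IsThin J] {L : Type} [SmallCategory L]
    (s : Vertex p × L ⥤ J) (lo hi : L ⥤ Vertex p) (hle : ∀ l, lo.obj l ≤ hi.obj l) (X : FDMod k J)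
    (hX : ∀ l, 1 < (lo.obj l).1 →
      Function.Injective (X.map (s.map (Prod.mkHom (homOfLE (pred_le lo hi hle l)) (𝟙 l))))) :
    Mono ((belowToTop s lo hi hle k).app X) := by
  have h : ∀ l, Mono (((belowToTop s lo hi hle k).app X).app l) := by
    intro l
    apply ConcreteCategory.mono_of_injective
    by_cases hl : 1 < (lo.obj l).1
    · intro φ ψ hφψ
      rw [belowToTop_apply s lo hi hle X l hl, belowToTop_apply s lo hi hle X l hl] at hφψ
      funext q
      exact hX l hl hφψ
    · have := subsingleton_below s lo X l hl
      exact Function.injective_of_subsingleton _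
  exact NatTrans.mono_of_mono_app _

/-- By `hs` the summand of index `c` does not change when the coordinate controlled by `s` moves, so
the transition maps in that direction are inclusions of partial sums. -/
lemma mono_belowToTop_free [Quiver.IsThin J] (hs : ∀ c c' j, s.obj (c, s.obj (c', j)) = s.obj (c, j))
    (lo hi : J ⥤ Vertex p) (hle : ∀ l, lo.obj l ≤ hi.obj l) (X : FDMod k J) :
    Mono ((belowToTop s lo hi hle k).app ((freeFunctor s r k).obj X)) := by
  apply mono_belowToTop_app_of_injective
  intro l _
  apply injective_extendTransition (fun c j => c ≤ r.obj j)
    (fun c => graphComp s ((Functor.const J).obj c)) (fun _ _ _ f h => h.trans (leOfHom (r.map f)))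
  intro c _
  exact isIso_of_thin _ (eqToHom ((hs _ _ _).trans (hs _ _ _).symm))

variable {D : Type} [SmallCategory D] (hs : ∀ c c' j, s.obj (c, s.obj (c', j)) = s.obj (c, j))
  (lo hi : J ⥤ Vertex p) (hle : ∀ l, lo.obj l ≤ hi.obj l)
  (q : J ⥤ D) {B : FDMod k ((Vertex p)ᵒᵖ × D)} {T : Set ((Vertex p)ᵒᵖ × D)}
  (G : StandardGen B T)
  (hT : ∀ c l, (op c, q.obj l) ∈ T ↔ lo.obj l ≤ c ∧ c ≤ hi.obj l)

/-- The left derived functor of the tensor product with a standard module whose support is given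
by intervals. -/
noncomputable def tensorLeftDerived [Quiver.IsThin J] [HasDerivedCategory.{w} (FDMod k J)] :
    LeftDerived (tensor s q B) :=
  LeftDerived.ofPresentation (belowToTop s lo hi hle k) (topToTensor s lo hi hle q G hT)
    (belowToTop_comp_topToTensor s lo hi hle q G hT)
    (exact_belowToTop_topToTensor s lo hi hle q G hT)
    (epi_topToTensor_app s lo hi hle q G hT)
    (freeFunctor s r k) (freeDesc s r hsr k) (epi_freeDesc_app s r hsr)
    (mono_belowToTop_free s r hs lo hi hle)

end

/-! ### Initial intervals: the tensor product as a restriction -/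

section

variable {k : Type u} [Field k] {p : ℕ} {D J L : Type} [SmallCategory D] [SmallCategory J]
  [SmallCategory L] [Quiver.IsThin J] (s : Vertex p × L ⥤ J)
  (lo hi : L ⥤ Vertex p) (hle : ∀ l, lo.obj l ≤ hi.obj l)
  (r : L ⥤ D) {B : FDMod k ((Vertex p)ᵒᵖ × D)} {T : Set ((Vertex p)ᵒᵖ × D)}
  (G : StandardGen B T)
  (hT : ∀ c l, (op c, r.obj l) ∈ T ↔ lo.obj l ≤ c ∧ c ≤ hi.obj l)

/-- With `lo = 1` nothing lies below the interval, so the quotient map has zero kernel. -/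
lemma isIso_topToTensor (hlo : ∀ l, (lo.obj l).1 = 1) :
    IsIso (topToTensor s lo hi hle r G hT) := by
  have h : ∀ X, IsIso ((topToTensor s lo hi hle r G hT).app X) := by
    intro X
    have h1 := epi_topToTensor_app s lo hi hle r G hT X
    have h2 : Mono ((topToTensor s lo hi hle r G hT).app X) := by
      refine (exact_belowToTop_topToTensor s lo hi hle r G hT X).mono_g ?_
      change (belowToTop s lo hi hle k).app X = 0
      ext1
      funext l
      apply ConcreteCategory.hom_ext
      intro φ
      have := subsingleton_below s lo X l (by rw [hlo]; exact lt_irrefl 1)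
      rw [Subsingleton.elim φ 0, map_zero, map_zero]
    exact isIso_of_mono_of_epi _
  exact NatIso.isIso_of_isIso_app _

/-- The tensor product with a standard module whose support is given by initial intervals. -/
noncomputable def topIsoTensor (hlo : ∀ l, (lo.obj l).1 = 1) : topFunctor s k hi ≅ tensor s r B :=
  have := isIso_topToTensor s lo hi hle r G hT hlo
  asIso (topToTensor s lo hi hle r G hT)

end

/-! ### Generators of standard modules and of the dual bimodule -/

section

variable (k : Type u) [Field k]

/-- The generators of a standard module. -/
noncomputable def standardGen {I : Type} [SmallCategory I] (T : Set I)
    (hT : ∀ ⦃a b c : I⦄, (a ⟶ b) → (b ⟶ c) → a ∈ T → c ∈ T → b ∈ T) :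
    StandardGen (standardModule k T hT) T where
  u x := FGModuleCat.ofHom (LinearMap.pi fun _ => LinearMap.id)
  e x := by
    classical
    exact FGModuleCat.ofHom (if h : x ∈ T then LinearMap.proj (PLift.up h) else 0)
  e_u x := by
    classical
    apply ConcreteCategory.hom_ext
    intro φ
    funext ⟨h⟩
    change (if h : x ∈ T then LinearMap.proj (PLift.up h) else 0 : (PLift (x ∈ T) → k) →ₗ[k] k) φ = _
    rw [dif_pos h]
    rfl
  u_e {x} hx := by
    classical
    apply ConcreteCategory.hom_ext
    intro c
    change (if h : x ∈ T then LinearMap.proj (PLift.up h) else 0 : (PLift (x ∈ T) → k) →ₗ[k] k)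
      (fun _ => c) = _
    rw [dif_pos hx]
    rfl
  u_zero {x} hx := by
    apply ConcreteCategory.hom_ext
    intro c
    funext ⟨h⟩
    exact (hx h).elim
  u_map {x y} f hx := by
    apply ConcreteCategory.hom_ext
    intro c
    funext ⟨h⟩
    exact dif_pos hx

/-- The generators of the dual bimodule of a thin category. -/
noncomputable def dualGen (C : Type) [SmallCategory C] [FinCategory C] [Quiver.IsThin C] :
    StandardGen (dualBimodule k C) {x | Nonempty (x.2 ⟶ x.1.unop)} where
  u x := FGModuleCat.ofHom (LinearMap.pi fun _ => LinearMap.id)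
  e x := by
    classical
    exact FGModuleCat.ofHom (if h : Nonempty (x.2 ⟶ x.1.unop) then LinearMap.proj h.some else 0)
  e_u x := by
    classical
    apply ConcreteCategory.hom_ext
    intro φ
    funext h
    change (if h : Nonempty (x.2 ⟶ x.1.unop) then LinearMap.proj h.some else 0 :
      ((x.2 ⟶ x.1.unop) → k) →ₗ[k] k) φ = _
    rw [dif_pos ⟨h⟩]
    exact congrArg φ (Subsingleton.elim _ _)
  u_e {x} hx := by
    classical
    apply ConcreteCategory.hom_ext
    intro c
    change (if h : Nonempty (x.2 ⟶ x.1.unop) then LinearMap.proj h.some else 0 :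
      ((x.2 ⟶ x.1.unop) → k) →ₗ[k] k) (fun _ => c) = _
    have hx' : Nonempty (x.2 ⟶ x.1.unop) := hx
    rw [dif_pos hx']
    rfl
  u_zero {x} hx := by
    apply ConcreteCategory.hom_ext
    intro c
    funext h
    exact (hx ⟨h⟩).elim
  u_map {x y} f hx := rfl

end

instance prod_isThin {C D : Type} [SmallCategory C] [SmallCategory D] [Quiver.IsThin C]
    [Quiver.IsThin D] : Quiver.IsThin (C × D) :=
  fun _ _ => ⟨fun _ _ => Prod.ext (Subsingleton.elim _ _) (Subsingleton.elim _ _)⟩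

instance op_isThin {C : Type} [SmallCategory C] [Quiver.IsThin C] : Quiver.IsThin Cᵒᵖ :=
  fun _ _ => ⟨fun _ _ => Quiver.Hom.unop_inj (Subsingleton.elim _ _)⟩

/-! ### Combinatorics of the supports -/

/-- The end point of the fiber of `S m n i` over `(μ, ν)`. -/
def fiberEnd (n i μ ν : ℕ) : ℕ := if μ < i then μ else if μ = i then i + ν - 1 else μ + n - 1

lemma mem_S_iff {m n i c μ ν : ℕ} (hc : c ∈ Set.Icc 1 (m + n - 1)) (hμ : μ ∈ Set.Icc 1 m)
    (hν : ν ∈ Set.Icc 1 n) : ![c, μ, ν] ∈ S m n i ↔ c ≤ fiberEnd n i μ ν := by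
  rw [Set.mem_Icc] at hc hμ hν
  simp only [S, box, Set.mem_ofPred_eq, Fin.forall_fin_succ, Matrix.cons_val, fiberEnd]
  simp
  split_ifs <;> omega

lemma injectiveDir_S (m n i : ℕ) : InjectiveDir (S m n i) 0 := by
  intro v hv l hl hl'
  simp only [S, box, Set.mem_ofPred_eq, Fin.forall_fin_succ, Matrix.cons_val,
    Function.update_apply] at hv ⊢
  simp at hv ⊢
  omega

lemma projectiveDir_S (m n i : ℕ) : ProjectiveDir ![m + n - 1, m, n] (S m n i) 1 := by
  intro v hv l hl hl'
  simp only [S, box, Set.mem_ofPred_eq, Fin.forall_fin_succ, Matrix.cons_val,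
    Function.update_apply] at hv hl' ⊢
  simp at hv hl' ⊢
  omega

/-- Both reversals are the points of the box with `γ ≥ fiberEnd n i μ ν`. On the right the condition
reads `μ = 1` or `γ > fiberEnd n (i - 1) (μ - 1) ν`, and the latter bound is `fiberEnd n i μ ν - 1`.
-/
lemma fiberReversal_S {m n i : ℕ} (hi : 2 ≤ i) (him : i ≤ m) :
    fiberReversalInj ![m + n - 1, m, n] (S m n i) 0 =
      fiberReversalProj ![m + n - 1, m, n] (S m n (i - 1)) 1 := by
  ext v
  simp only [fiberReversalInj, fiberReversalProj, S, box, Set.mem_ofPred_eq, Fin.forall_fin_succ,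
    Matrix.cons_val, Function.update_apply]
  simp
  omega

/-- The functor `(μ, ν) ↦ fiberEnd n i μ ν`. -/
def fiberEndFunctor (m n i : ℕ) : Vertex m × Vertex n ⥤ Vertex (m + n - 1) where
  obj l := ⟨fiberEnd n i l.1.1 l.2.1, by
    have h1 := l.1.2
    have h2 := l.2.2
    rw [Set.mem_Icc] at h1 h2 ⊢
    unfold fiberEnd
    split_ifs <;> omega⟩
  -- Monotone: `ν` matters only in the row `μ = i`, whose values lie between `i` and `i + n - 1`,
  -- thus between the neighbouring rows.
  map {a b} f := homOfLE (by
    have h1 : a.1.1 ≤ b.1.1 := Subtype.coe_le_coe.2 (leOfHom f.1)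
    have h2 : a.2.1 ≤ b.2.1 := Subtype.coe_le_coe.2 (leOfHom f.2)
    have h3 := a.2.2
    have h4 := b.2.2
    rw [Set.mem_Icc] at h3 h4
    apply Subtype.coe_le_coe.1
    dsimp only [fiberEnd]
    split_ifs <;> omega)

/-- The support of `M k m n i`. -/
abbrev suppM (m n i : ℕ) : Set ((Vertex (m + n - 1))ᵒᵖ × Vertex m × Vertex n) :=
  {x | ![x.1.unop.1, x.2.1.1, x.2.2.1] ∈ S m n i}

lemma mem_suppM (m n i : ℕ) (c : Vertex (m + n - 1)) (l : Vertex m × Vertex n) :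
    (op c, l) ∈ suppM m n i ↔ c ≤ (fiberEndFunctor m n i).obj l :=
  mem_S_iff c.2 l.1.2 l.2.2

/-- The constant functor at the first vertex. -/
abbrev firstVertex {p : ℕ} (hp : 1 ≤ p) (L : Type) [SmallCategory L] : L ⥤ Vertex p :=
  (Functor.const L).obj ⟨1, le_rfl, hp⟩

/-- The constant functor at the last vertex. -/
abbrev lastVertex {p : ℕ} (hp : 1 ≤ p) (L : Type) [SmallCategory L] : L ⥤ Vertex p :=
  (Functor.const L).obj ⟨p, hp, le_rfl⟩

lemma first_le {p : ℕ} (hp : 1 ≤ p) (b : Vertex p) : (⟨1, le_rfl, hp⟩ : Vertex p) ≤ b := b.2.1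

lemma le_last {p : ℕ} (hp : 1 ≤ p) (b : Vertex p) : b ≤ (⟨p, hp, le_rfl⟩ : Vertex p) := b.2.2

/-! ### The functors of the theorem as restrictions and cones -/

section

variable (k : Type u) [Field k] {m n i : ℕ}

/-- The generators of `M k m n i`. -/
noncomputable def genM (m n i : ℕ) : StandardGen (M k m n i) (suppM m n i) := standardGen k _ _

/-- The generators of `N k p`. -/
noncomputable def genN (p : ℕ) : StandardGen (N k p) {x | x.2 ≤ x.1.unop} := standardGen k _ _

/-- The index functor of `nabla` and `nakayama`. -/
abbrev fstIndex (C L : Type) [SmallCategory C] [SmallCategory L] : C × L ⥤ C where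
  obj x := x.1
  map f := f.1

/-- The index functor of `tensorM`. -/
abbrev tensorMIndex (m n : ℕ) :
    Vertex (m + n - 1) × ((Vertex (m + n - 1))ᵒᵖ × Vertex m × Vertex n) ⥤
      (Vertex (m + n - 1))ᵒᵖ × Vertex (m + n - 1) where
  obj x := (x.2.1, x.1)
  map f := Prod.mkHom f.2.1 f.1

/-- The index functor of `nakayamaProdId`. -/
abbrev nakayamaProdIdIndex (m n : ℕ) : Vertex m × (Vertex m × Vertex n) ⥤ Vertex m × Vertex n where
  obj x := (x.1, x.2.2)
  map f := Prod.mkHom f.1 f.2.2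

/-- The index functor of `tensorN`. -/
abbrev tensorNIndex (p m n : ℕ) : Vertex m × ((Vertex p)ᵒᵖ × Vertex m × Vertex n) ⥤
    (Vertex p)ᵒᵖ × Vertex m × Vertex n where
  obj x := (x.2.1, x.1, x.2.2.2)
  map f := Prod.mkHom f.2.1 (Prod.mkHom f.1 f.2.2.2)

/-- Tensoring with `M k m n i` is a restriction. -/
noncomputable def nablaIso (hp : 1 ≤ m + n - 1) :
    precomp k (fiberEndFunctor m n i) ≅ nabla k m n i :=
  topIsoTensor (fstIndex (Vertex (m + n - 1)) (Vertex m × Vertex n)) (firstVertex hp _)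
    (fiberEndFunctor m n i) (fun _ => first_le hp _) (𝟭 _) (genM k m n i)
    (fun c l => (mem_suppM m n i c l).trans (and_iff_right (first_le hp c)).symm) (fun _ => rfl)

/-- Tensoring with `M k m n i` is a restriction. -/
noncomputable def tensorMIso (hp : 1 ≤ m + n - 1) :
    precomp k (Functor.prod (𝟭 (Vertex (m + n - 1))ᵒᵖ) (fiberEndFunctor m n i)) ≅
      tensorM k m n i :=
  topIsoTensor (tensorMIndex m n) (firstVertex hp _) (CategoryTheory.Prod.snd _ _ ⋙ fiberEndFunctor m n i)
    (fun _ => first_le hp _) _ (genM k m n i)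
    (fun c l => (mem_suppM m n i c l.2).trans (and_iff_right (first_le hp c)).symm) (fun _ => rfl)

lemma preservesFiniteLimits_nabla (hp : 1 ≤ m + n - 1) :
    PreservesFiniteLimits (nabla k m n i) := preservesFiniteLimits_of_natIso (nablaIso k hp)

lemma preservesFiniteColimits_nabla (hp : 1 ≤ m + n - 1) :
    PreservesFiniteColimits (nabla k m n i) := preservesFiniteColimits_of_natIso (nablaIso k hp)

lemma preservesFiniteLimits_tensorM (hp : 1 ≤ m + n - 1) :
    PreservesFiniteLimits (tensorM k m n i) := preservesFiniteLimits_of_natIso (tensorMIso k hp)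

lemma preservesFiniteColimits_tensorM (hp : 1 ≤ m + n - 1) :
    PreservesFiniteColimits (tensorM k m n i) := preservesFiniteColimits_of_natIso (tensorMIso k hp)

/-- The map whose cone is the derived Nakayama functor. -/
noncomputable abbrev nakayamaMap {p : ℕ} (hp : 1 ≤ p) :
    belowFunctor (fstIndex (Vertex p) (Vertex p)) k (𝟭 _) ⟶
      topFunctor (fstIndex (Vertex p) (Vertex p)) k (lastVertex hp _) :=
  belowToTop _ (𝟭 _) (lastVertex hp _) (fun _ => le_last hp _) k

/-- The left derived functor of the Nakayama functor. -/
noncomputable def nakayamaLeftDerived {p : ℕ} (hp : 1 ≤ p)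
    [HasDerivedCategory.{w} (FDMod k (Vertex p))] : LeftDerived (nakayama k p) :=
  tensorLeftDerived (fstIndex (Vertex p) (Vertex p)) (𝟭 _) (fun _ => rfl) (fun _ _ _ => rfl)
    (𝟭 _) (lastVertex hp _) (fun _ => le_last hp _) (𝟭 _) (dualGen k (Vertex p))
    (fun c _ => ⟨fun ⟨f⟩ => ⟨leOfHom f, le_last hp c⟩, fun h => ⟨homOfLE h.1⟩⟩)

/-- The map whose cone is the derived Nakayama functor in the first direction. -/
noncomputable abbrev nakayamaProdIdMap (n : ℕ) (hm : 1 ≤ m) :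
    belowFunctor (nakayamaProdIdIndex m n) k (CategoryTheory.Prod.fst _ _) ⟶
      topFunctor (nakayamaProdIdIndex m n) k (lastVertex hm _) :=
  belowToTop _ (CategoryTheory.Prod.fst _ _) (lastVertex hm _) (fun _ => le_last hm _) k

/-- The left derived functor of the Nakayama functor in the first direction. -/
noncomputable def nakayamaProdIdLeftDerived (n : ℕ) (hm : 1 ≤ m)
    [HasDerivedCategory.{w} (FDMod k (Vertex m × Vertex n))] :
    LeftDerived (nakayamaProdId k m n) :=
  tensorLeftDerived (nakayamaProdIdIndex m n) (CategoryTheory.Prod.fst _ _) (fun _ => rfl) (fun _ _ _ => rfl)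
    (CategoryTheory.Prod.fst _ _) (lastVertex hm _) (fun _ => le_last hm _) _ (dualGen k (Vertex m))
    (fun c _ => ⟨fun ⟨f⟩ => ⟨leOfHom f, le_last hm c⟩, fun h => ⟨homOfLE h.1⟩⟩)

/-- The quotient map onto the tensor product with `N`. -/
noncomputable abbrev topToTensorN (p n : ℕ) (hm : 1 ≤ m) :
    topFunctor (tensorNIndex p m n) k (lastVertex hm _) ⟶ tensorN k p m n :=
  topToTensor (tensorNIndex p m n) (CategoryTheory.Prod.snd _ _ ⋙ CategoryTheory.Prod.fst _ _) (lastVertex hm _)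
    (fun _ => le_last hm _) _ (genN k m) (fun c _ => (and_iff_left (le_last hm c)).symm)

/-- The map whose cone is the derived tensor product with `N`. -/
noncomputable abbrev tensorNMap (p n : ℕ) (hm : 1 ≤ m) :
    belowFunctor (tensorNIndex p m n) k (CategoryTheory.Prod.snd _ _ ⋙ CategoryTheory.Prod.fst _ _) ⟶
      topFunctor (tensorNIndex p m n) k (lastVertex hm _) :=
  belowToTop _ (CategoryTheory.Prod.snd _ _ ⋙ CategoryTheory.Prod.fst _ _) (lastVertex hm _)
    (fun _ => le_last hm _) k

/-- The left derived functor of the tensor product with `N`. -/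
noncomputable def tensorNLeftDerived (p n : ℕ) (hm : 1 ≤ m)
    [HasDerivedCategory.{w} (FDMod k ((Vertex p)ᵒᵖ × Vertex m × Vertex n))] :
    LeftDerived (tensorN k p m n) :=
  tensorLeftDerived (tensorNIndex p m n) (CategoryTheory.Prod.snd _ _ ⋙ CategoryTheory.Prod.fst _ _) (fun _ => rfl)
    (fun _ _ _ => rfl) (CategoryTheory.Prod.snd _ _ ⋙ CategoryTheory.Prod.fst _ _) (lastVertex hm _)
    (fun _ => le_last hm _) _ (genN k m) (fun c _ => (and_iff_left (le_last hm c)).symm)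

end

/-! ### Comparison of extensions by zero -/

section

variable {k : Type u} [Field k] {J L : Type} [SmallCategory J] [SmallCategory L]
  [Quiver.IsThin J] {ι : Type} {P P' : ι → L → Prop} {g g' : ι → L ⥤ J}

/-- The components of `extendIso`. -/
noncomputable def extendMapComponent (hPP' : ∀ i l, P' i l → P i l)
    (t : ∀ i l, P' i l → ((g i).obj l ⟶ (g' i).obj l)) (X : FDMod k J) (l : L) :
    ((q : {i // P i l}) → X.obj ((g q.1).obj l)) →ₗ[k]
      ((q : {i // P' i l}) → X.obj ((g' q.1).obj l)) where
  toFun φ q := X.map (t q.1 l q.2) (φ ⟨q.1, hPP' _ _ q.2⟩)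
  map_add' φ ψ := by ext q; simp
  map_smul' c φ := by ext q; simp

lemma extendMapComponent_transition (h : ∀ i l, P i l ↔ P' i l)
    (t : ∀ i l, P' i l → ((g i).obj l ⟶ (g' i).obj l)) (X : FDMod k J) {a b : L} (f : a ⟶ b) :
    extendMapComponent (fun i l => (h i l).2) t X b ∘ₗ extendTransition P g X f =
      extendTransition P' g' X f ∘ₗ extendMapComponent (fun i l => (h i l).2) t X a := by
  refine LinearMap.ext fun φ => funext fun q => ?_
  change X.map _ (extendTransition P g X f φ ⟨q.1, (h _ _).2 q.2⟩) =
    extendTransition P' g' X f (extendMapComponent (fun i l => (h i l).2) t X a φ) q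
  by_cases hq : P q.1 a
  · rw [extendTransition_pos P g X f φ ⟨q.1, (h _ _).2 q.2⟩ hq,
      extendTransition_pos P' g' X f _ q ((h _ _).1 hq)]
    change _ = X.map _ (X.map _ _)
    rw [map_map_apply, map_map_apply]
    exact congrArg (fun y => X.map y (φ ⟨q.1, hq⟩)) (Subsingleton.elim _ _)
  · rw [extendTransition_neg P g X f φ ⟨q.1, (h _ _).2 q.2⟩ hq,
      extendTransition_neg P' g' X f _ q (fun hq' => hq ((h _ _).2 hq')), map_zero]

lemma extendMapComponent_comp (h : ∀ i l, P i l ↔ P' i l)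
    (t : ∀ i l, P' i l → ((g i).obj l ⟶ (g' i).obj l))
    (t' : ∀ i l, P i l → ((g' i).obj l ⟶ (g i).obj l)) (X : FDMod k J) (l : L) :
    extendMapComponent (fun i l => (h i l).1) t' X l ∘ₗ
      extendMapComponent (fun i l => (h i l).2) t X l = LinearMap.id := by
  refine LinearMap.ext fun φ => funext fun q => ?_
  change X.map _ (X.map _ _) = φ q
  rw [map_map_apply, Subsingleton.elim (t _ _ _ ≫ t' _ _ _) (𝟙 _), X.map_id]
  rfl

/-- The functor `extend` only depends on the values of `g` at the points where `P` holds. -/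
noncomputable def extendIso [Finite ι] (hP : ∀ i {a b : L}, (a ⟶ b) → P i a → P i b)
    (hP' : ∀ i {a b : L}, (a ⟶ b) → P' i a → P' i b) (h : ∀ i l, P i l ↔ P' i l)
    (t : ∀ i l, P' i l → ((g i).obj l ⟶ (g' i).obj l))
    (t' : ∀ i l, P i l → ((g' i).obj l ⟶ (g i).obj l)) :
    extend (k := k) P g hP ≅ extend P' g' hP' :=
  NatIso.ofComponents (fun X =>
    NatIso.ofComponents (fun l =>
      { hom := FGModuleCat.ofHom (extendMapComponent (fun i l => (h i l).2) t X l)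
        inv := FGModuleCat.ofHom (extendMapComponent (fun i l => (h i l).1) t' X l)
        hom_inv_id := congrArg FGModuleCat.ofHom (extendMapComponent_comp h t t' X l)
        inv_hom_id := congrArg FGModuleCat.ofHom
          (extendMapComponent_comp (fun i l => (h i l).symm) t' t X l) })
      (fun f => congrArg FGModuleCat.ofHom (extendMapComponent_transition h t X f)))
    (fun α => by
      ext1
      funext l
      apply ConcreteCategory.hom_ext
      intro φ
      funext q
      exact (naturality_apply α _ _).symm)

end

/-! ### Commutation of `∇` with the Nakayama functors -/

section

variable {m n i : ℕ}

/-- As `i ≥ 2`, the row `μ = 1` lies in the range `μ < i` and ends at `1`; any other row ends at `μ`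
or later. The two below functors are therefore nonzero at the same vertices. -/
lemma one_lt_fiberEnd (hi : 2 ≤ i) (l : Vertex m × Vertex n) :
    1 < ((fiberEndFunctor m n i).obj l).1 ↔ 1 < l.1.1 := by
  have h1 := l.1.2
  have h2 := l.2.2
  rw [Set.mem_Icc] at h1 h2
  dsimp only [fiberEndFunctor, fiberEnd]
  split_ifs <;> omega

/-- Lowering `i` and `μ` together preserves the three cases of `fiberEnd` and lowers each value by
one. This is the combinatorial heart of the theorem. -/
lemma pred_fiberEnd (hi : 2 ≤ i) (l : Vertex m × Vertex n) (hl : 1 < l.1.1) :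
    (predVertex _).obj ((fiberEndFunctor m n i).obj l) =
      (fiberEndFunctor m n (i - 1)).obj ((predVertex m).obj l.1, l.2) := by
  have h1 := l.1.2
  have h2 := l.2.2
  rw [Set.mem_Icc] at h1 h2
  apply Subtype.ext
  dsimp only [fiberEndFunctor, fiberEnd, predVertex]
  split_ifs <;> omega

/-- Since `i - 1 < m`, the last row falls in the third case, whatever `ν` is. -/
lemma fiberEnd_last (hm : 1 ≤ m) (hp : 1 ≤ m + n - 1) (hi : 2 ≤ i) (him : i ≤ m) (b : Vertex n) :
    (fiberEndFunctor m n (i - 1)).obj (⟨m, hm, le_rfl⟩, b) = ⟨m + n - 1, hp, le_rfl⟩ := by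
  apply Subtype.ext
  dsimp only [fiberEndFunctor, fiberEnd]
  split_ifs <;> omega

variable (k : Type u) [Field k] (hm : 1 ≤ m) (hp : 1 ≤ m + n - 1) (hi : 2 ≤ i) (him : i ≤ m)

/-- Compatibility of restriction along `fiberEndFunctor` with `belowFunctor`. -/
noncomputable def belowPrecompIso :
    belowFunctor (fstIndex (Vertex (m + n - 1)) (Vertex (m + n - 1))) k (𝟭 _) ⋙
        precomp k (fiberEndFunctor m n i) ≅
      precomp k (fiberEndFunctor m n (i - 1)) ⋙
        belowFunctor (nakayamaProdIdIndex m n) k (CategoryTheory.Prod.fst _ _) :=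
  extendIso (ι := Unit) (P := fun _ l => 1 < ((fiberEndFunctor m n i).obj l).1)
    (P' := fun _ l => 1 < l.1.1)
    (g := fun _ => fiberEndFunctor m n i ⋙ graphComp (fstIndex _ _) (𝟭 _ ⋙ predVertex _))
    (g' := fun _ => graphComp (nakayamaProdIdIndex m n) (CategoryTheory.Prod.fst _ _ ⋙
      predVertex m) ⋙ fiberEndFunctor m n (i - 1))
    (fun q _ _ f h => upward_one_lt (fiberEndFunctor m n i) q f h)
    (fun q _ _ f h => upward_one_lt (CategoryTheory.Prod.fst _ _) q f h)
    (fun _ l => one_lt_fiberEnd hi l)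
    (fun _ l h => eqToHom (pred_fiberEnd hi l h))
    (fun _ l h => eqToHom (pred_fiberEnd hi l ((one_lt_fiberEnd hi l).1 h)).symm)

/-- Compatibility of restriction along `fiberEndFunctor` with `topFunctor`. -/
noncomputable def topPrecompIso :
    topFunctor (fstIndex (Vertex (m + n - 1)) (Vertex (m + n - 1))) k (lastVertex hp _) ⋙
        precomp k (fiberEndFunctor m n i) ≅
      precomp k (fiberEndFunctor m n (i - 1)) ⋙
        topFunctor (nakayamaProdIdIndex m n) k (lastVertex hm _) :=
  (Functor.whiskeringLeft _ _ (FGModuleCat.{u} k)).mapIso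
    (NatIso.ofComponents
      (F := fiberEndFunctor m n i ⋙ graphComp (fstIndex _ _) (lastVertex hp _))
      (G := graphComp (nakayamaProdIdIndex m n) (lastVertex hm _) ⋙ fiberEndFunctor m n (i - 1))
      (fun l => eqToIso (fiberEnd_last hm hp hi him l.2).symm)
      (fun _ => Subsingleton.elim _ _))

/-- Where `μ > 1`, both sides are `X` applied to parallel arrows of a thin category; where `μ = 1`
the source is zero. -/
lemma precompIso_comm (X : FDMod k (Vertex (m + n - 1))) :
    (precomp k (fiberEndFunctor m n i)).map ((nakayamaMap k hp).app X) ≫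
        (topPrecompIso k hm hp hi him).hom.app X =
      (belowPrecompIso k hi).hom.app X ≫
        (nakayamaProdIdMap k n hm).app ((precomp k (fiberEndFunctor m n (i - 1))).obj X) := by
  ext1
  funext l
  apply ConcreteCategory.hom_ext
  intro φ
  change X.map _ ((((nakayamaMap k hp).app X).app ((fiberEndFunctor m n i).obj l)) φ) =
    ((nakayamaProdIdMap k n hm).app ((precomp k (fiberEndFunctor m n (i - 1))).obj X)).app l
      (((belowPrecompIso k hi).hom.app X).app l φ)
  by_cases hl : 1 < l.1.1
  · have hl' := (one_lt_fiberEnd hi l).2 hl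
    refine (congrArg _ (belowToTop_apply (fstIndex _ _) (𝟭 _) (lastVertex hp _) _ X
      ((fiberEndFunctor m n i).obj l) hl' φ)).trans (Eq.trans ?_
      (belowToTop_apply (nakayamaProdIdIndex m n) _ (lastVertex hm _) _
        ((precomp k (fiberEndFunctor m n (i - 1))).obj X) l hl _).symm)
    change X.map _ (X.map _ _) = X.map _ (X.map _ _)
    rw [map_map_apply, map_map_apply]
    exact congrArg (fun y => X.map y (φ ⟨(), hl'⟩)) (Subsingleton.elim _ _)
  · have := subsingleton_below (k := k) (fstIndex (Vertex (m + n - 1)) (Vertex (m + n - 1))) (𝟭 _) X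
      ((fiberEndFunctor m n i).obj l) (fun h => hl ((one_lt_fiberEnd hi l).1 h))
    have h0 : φ = 0 := this.elim _ _
    rw [h0, map_zero, map_zero, map_zero, map_zero]

section

variable [HasDerivedCategory.{w} (FDMod k (Vertex (m + n - 1)))]
  [HasDerivedCategory.{w} (FDMod k (Vertex m × Vertex n))]

/-- The left derived functor of `nabla` is a restriction. -/
noncomputable def nablaTotalIso (nab : LeftDerived (nabla k m n i)) :
    nab.total ≅ (precomp k (fiberEndFunctor m n i)).mapDerivedCategory :=
  nab.totalIso (LeftDerived.ofExact (precomp k (fiberEndFunctor m n i))) (nablaIso k hp).symm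

/-- The commutation relation between the derived Nakayama functors and `nabla`. -/
noncomputable def derivedNakayamaCompIso
    (nab : LeftDerived (nabla k m n i)) (nab' : LeftDerived (nabla k m n (i - 1)))
    (nak : LeftDerived (nakayama k (m + n - 1))) (nakId : LeftDerived (nakayamaProdId k m n)) :
    nak.total ⋙ nab.total ≅ nab'.total ⋙ nakId.total :=
  -- By uniqueness of left derived functors, the given ones may be replaced by explicit cones and
  -- restrictions.
  NatIso.hcomp (nak.totalIso (nakayamaLeftDerived k hp) (Iso.refl _)) (nablaTotalIso k hp nab) ≪≫
    derivedConeCompIso (nakayamaMap k hp) (nakayamaProdIdMap k n hm)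
      (precomp k (fiberEndFunctor m n i)) (precomp k (fiberEndFunctor m n (i - 1)))
      (belowPrecompIso k hi) (topPrecompIso k hm hp hi him) (precompIso_comm k hm hp hi him) ≪≫
    (NatIso.hcomp (nablaTotalIso k hp nab')
      (nakId.totalIso (nakayamaProdIdLeftDerived k n hm) (Iso.refl _))).symm

/-- The derived functor of `nabla` commutes with the shift. -/
noncomputable def nablaShiftIso (nab : LeftDerived (nabla k m n i)) :
    shiftFunctor _ (-1 : ℤ) ⋙ nab.total ≅ nab.total ⋙ shiftFunctor _ (-1 : ℤ) :=
  Functor.isoWhiskerLeft _ (nablaTotalIso k hp nab) ≪≫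
    (precomp k (fiberEndFunctor m n i)).mapDerivedCategory.commShiftIso (-1 : ℤ) ≪≫
    Functor.isoWhiskerRight (nablaTotalIso k hp nab).symm _

end

end

/-! ### The isomorphism of bimodules -/

section

variable {k : Type u} [Field k] {I : Type} [SmallCategory I] {T : Set I}
  (hT : ∀ ⦃a b c : I⦄, (a ⟶ b) → (b ⟶ c) → a ∈ T → c ∈ T → b ∈ T) {a b : I} (f : a ⟶ b)

lemma standardModule_map_apply (ha : a ∈ T) (φ : (standardModule k T hT).obj a) (hb : PLift (b ∈ T)) :
    ((standardModule k T hT).map f φ : PLift (b ∈ T) → k) hb =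
      (φ : PLift (a ∈ T) → k) ⟨ha⟩ := dif_pos ha

lemma injective_standardModule_map (h : a ∈ T → b ∈ T) :
    Function.Injective ((standardModule k T hT).map f) := by
  intro φ ψ hφψ
  funext ⟨ha⟩
  rw [← standardModule_map_apply hT f ha φ ⟨h ha⟩, hφψ, standardModule_map_apply hT f ha ψ ⟨h ha⟩]

lemma surjective_standardModule_map (ha : a ∈ T) :
    Function.Surjective ((standardModule k T hT).map f) := by
  intro ψ
  by_cases hb : b ∈ T
  · exact ⟨fun _ => (ψ : PLift (b ∈ T) → k) ⟨hb⟩,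
      funext fun ⟨_⟩ => standardModule_map_apply hT f ha _ _⟩
  · exact ⟨0, funext fun ⟨h⟩ => (hb h).elim⟩

end

section

variable (k : Type u) [Field k] {m n i : ℕ} (hm : 1 ≤ m) (hp : 1 ≤ m + n - 1) (hi : 2 ≤ i)
  (him : i ≤ m)

/-- The fibre over the last row is the whole of `[1, m + n - 1]`, so `M k m n (i - 1)` is
one-dimensional everywhere in that row. -/
lemma mem_suppM_last (hi : 2 ≤ i) (him : i ≤ m)
    (l : (Vertex (m + n - 1))ᵒᵖ × Vertex m × Vertex n) :
    (l.1, (⟨m, hm, le_rfl⟩ : Vertex m), l.2.2) ∈ suppM m n (i - 1) := by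
  refine (mem_suppM m n (i - 1) l.1.unop _).2 ?_
  rw [fiberEnd_last hm (l.1.unop.2.1.trans l.1.unop.2.2) hi him]
  exact l.1.unop.2.2

/-- The bimodule `N`, restricted along `fiberEndFunctor`. -/
noncomputable abbrev restrictN (m n i : ℕ) : FDMod k ((Vertex (m + n - 1))ᵒᵖ × Vertex m × Vertex n) :=
  (precomp k (Functor.prod (𝟭 (Vertex (m + n - 1))ᵒᵖ) (fiberEndFunctor m n i))).obj
    (N k (m + n - 1))

lemma restrictN_map_apply {a b : (Vertex (m + n - 1))ᵒᵖ × Vertex m × Vertex n} (f : a ⟶ b)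
    (ha : (fiberEndFunctor m n i).obj a.2 ≤ a.1.unop) (φ : (restrictN k m n i).obj a)
    (hb : PLift ((fiberEndFunctor m n i).obj b.2 ≤ b.1.unop)) :
    ((restrictN k m n i).map f φ : PLift ((fiberEndFunctor m n i).obj b.2 ≤ b.1.unop) → k) hb =
      (φ : PLift ((fiberEndFunctor m n i).obj a.2 ≤ a.1.unop) → k) ⟨ha⟩ := dif_pos ha

lemma isZero_restrictN_obj (l : (Vertex (m + n - 1))ᵒᵖ × Vertex m × Vertex n)
    (hl : ¬ (fiberEndFunctor m n i).obj l.2 ≤ l.1.unop) : IsZero ((restrictN k m n i).obj l) := by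
  rw [IsZero.iff_id_eq_zero]
  apply ConcreteCategory.hom_ext
  intro φ
  exact funext fun ⟨h⟩ => (hl h).elim

lemma topM_map_apply {a b : (Vertex (m + n - 1))ᵒᵖ × Vertex m × Vertex n} (f : a ⟶ b)
    (φ : ((topFunctor (tensorNIndex (m + n - 1) m n) k (lastVertex hm _)).obj
      (M k m n (i - 1))).obj a) :
    (((topFunctor (tensorNIndex (m + n - 1) m n) k (lastVertex hm _)).obj
      (M k m n (i - 1))).map f φ : PLift (_ ∈ suppM m n (i - 1)) → k)
        ⟨mem_suppM_last hm hi him b⟩ =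
      (φ : PLift (_ ∈ suppM m n (i - 1)) → k) ⟨mem_suppM_last hm hi him a⟩ :=
  dif_pos (mem_suppM_last hm hi him a)

/-- The components of `topMToN`. -/
noncomputable def topMToNApp (l : (Vertex (m + n - 1))ᵒᵖ × Vertex m × Vertex n) :
    ((topFunctor (tensorNIndex (m + n - 1) m n) k (lastVertex hm _)).obj (M k m n (i - 1))).obj l ⟶
      (restrictN k m n i).obj l :=
  FGModuleCat.ofHom
    (LinearMap.pi fun _ => LinearMap.proj (PLift.up (mem_suppM_last hm hi him l)))

/-- The projection from the restriction of `M k m n (i - 1)` to the last vertex in the first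
direction. -/
noncomputable def topMToN :
    (topFunctor (tensorNIndex (m + n - 1) m n) k (lastVertex hm _)).obj (M k m n (i - 1)) ⟶
      restrictN k m n i where
  app l := topMToNApp k hm hi him l
  naturality l l' f := by
    apply ConcreteCategory.hom_ext
    intro φ
    funext ⟨h⟩
    -- The support of `restrictN` is closed under passing to sources of arrows, so a nonzero target
    -- coordinate has a nonzero source.
    have h' : (fiberEndFunctor m n i).obj l.2 ≤ l.1.unop :=
      (leOfHom ((fiberEndFunctor m n i).map f.2)).trans (h.trans (leOfHom f.1.unop))
    exact (topM_map_apply k hm hi him f φ).trans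
      (restrictN_map_apply k f h' (topMToNApp k hm hi him l φ) ⟨h⟩).symm

lemma isIso_topMToN_app (l : (Vertex (m + n - 1))ᵒᵖ × Vertex m × Vertex n)
    (hl : (fiberEndFunctor m n i).obj l.2 ≤ l.1.unop) :
    IsIso ((topMToN k hm hi him).app l) := by
  have h1 : Mono ((topMToN k hm hi him).app l) := by
    apply ConcreteCategory.mono_of_injective
    intro φ ψ h
    funext ⟨_⟩
    exact congrFun h ⟨hl⟩
  have h2 : Epi ((topMToN k hm hi him).app l) := by
    apply ConcreteCategory.epi_of_surjective
    intro ψ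
    exact ⟨fun _ => (ψ : PLift ((fiberEndFunctor m n i).obj l.2 ≤ l.1.unop) → k) ⟨hl⟩,
      funext fun ⟨_⟩ => rfl⟩
  exact isIso_of_mono_of_epi _

include hi in
lemma one_lt_of_lt_fiberEnd (l : (Vertex (m + n - 1))ᵒᵖ × Vertex m × Vertex n)
    (hl : ¬ (fiberEndFunctor m n i).obj l.2 ≤ l.1.unop) : 1 < l.2.1.1 := by
  rw [← one_lt_fiberEnd hi l.2]
  exact lt_of_le_of_lt l.1.unop.2.1 (Subtype.coe_lt_coe.2 (not_le.1 hl))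

include hi in
-- By `pred_fiberEnd` the left side says that the first coordinate is at most one less than the
-- fibre end. For `μ > 1`, exactly one of the source of `tensorNMap` and `restrictN` is thus nonzero
-- at `l`.
lemma pred_mem_suppM (l : (Vertex (m + n - 1))ᵒᵖ × Vertex m × Vertex n) (hl : 1 < l.2.1.1) :
    (l.1, (predVertex m).obj l.2.1, l.2.2) ∈ suppM m n (i - 1) ↔
      ¬ (fiberEndFunctor m n i).obj l.2 ≤ l.1.unop := by
  refine (mem_suppM m n (i - 1) l.1.unop _).trans ?_
  rw [← pred_fiberEnd hi l.2 hl, ← Subtype.coe_le_coe, ← Subtype.coe_le_coe]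
  have h1 := (one_lt_fiberEnd hi l.2).2 hl
  dsimp only [predVertex]
  omega

/-- At every vertex either the source or the target vanishes. -/
lemma tensorNMap_comp_topMToN :
    (tensorNMap k (m + n - 1) n hm).app (M k m n (i - 1)) ≫ topMToN k hm hi him = 0 := by
  ext1
  funext l
  by_cases hl : (fiberEndFunctor m n i).obj l.2 ≤ l.1.unop
  · have h : IsZero (((belowFunctor (tensorNIndex (m + n - 1) m n) k
        (CategoryTheory.Prod.snd _ _ ⋙ CategoryTheory.Prod.fst _ _)).obj (M k m n (i - 1))).obj l) := by
      rw [IsZero.iff_id_eq_zero]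
      apply ConcreteCategory.hom_ext
      intro φ
      funext ⟨q, hq⟩
      funext ⟨hq'⟩
      exact ((pred_mem_suppM hi l hq).1 hq' hl).elim
    exact h.eq_of_src _ _
  · exact (isZero_restrictN_obj k l hl).eq_of_tgt _ _

include hi him in
-- The transition maps end in the last row, which lies wholly in the support, so they kill nothing.
-- Hence the derived tensor product with `N` is concentrated in degree `0`.
lemma mono_tensorNMap_M : Mono ((tensorNMap k (m + n - 1) n hm).app (M k m n (i - 1))) := by
  apply mono_belowToTop_app_of_injective
  intro l _
  exact injective_standardModule_map _ _ (fun _ => mem_suppM_last hm hi him l)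

include hi in
lemma epi_tensorNMap_M_app (l : (Vertex (m + n - 1))ᵒᵖ × Vertex m × Vertex n)
    (hl : ¬ (fiberEndFunctor m n i).obj l.2 ≤ l.1.unop) :
    Epi (((tensorNMap k (m + n - 1) n hm).app (M k m n (i - 1))).app l) := by
  have hl' := one_lt_of_lt_fiberEnd hi l hl
  apply ConcreteCategory.epi_of_surjective
  intro ψ
  obtain ⟨φ, hφ⟩ := surjective_standardModule_map (k := k) (T := suppM m n (i - 1)) _
    ((tensorNIndex (m + n - 1) m n).map (Prod.mkHom (homOfLE (pred_le
      (CategoryTheory.Prod.snd _ _ ⋙ CategoryTheory.Prod.fst _ _) (lastVertex hm _)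
      (fun _ => le_last hm _) l)) (𝟙 l))) ((pred_mem_suppM hi l hl').2 hl) ψ
  exact ⟨fun _ => φ, (belowToTop_apply _ _ _ _ _ l hl' _).trans hφ⟩

lemma tensorNMap_comp_topToTensorN (p : ℕ) :
    tensorNMap k p n hm ≫ topToTensorN k p n hm = 0 :=
  belowToTop_comp_topToTensor _ _ _ _ _ _ _

lemma exact_tensorN (p : ℕ) (X : FDMod k ((Vertex p)ᵒᵖ × Vertex m × Vertex n)) :
    (evalObj (tensorNMap k p n hm) (topToTensorN k p n hm)
      (tensorNMap_comp_topToTensorN k hm p) X).Exact :=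
  exact_belowToTop_topToTensor _ _ _ _ _ _ _ X

lemma epi_topToTensorN_app (p : ℕ) (X : FDMod k ((Vertex p)ᵒᵖ × Vertex m × Vertex n)) :
    Epi ((topToTensorN k p n hm).app X) := epi_topToTensor_app _ _ _ _ _ _ _ X

include hm hi him in
/-- The two tensor products of bimodules are isomorphic. -/
lemma nonempty_tensorN_M_iso (hp : 1 ≤ m + n - 1) :
    Nonempty ((tensorN k (m + n - 1) m n).obj (M k m n (i - 1)) ≅
      (tensorM k m n i).obj (N k (m + n - 1))) := by
  let α := (tensorNMap k (m + n - 1) n hm).app (M k m n (i - 1))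
  let β := (topToTensorN k (m + n - 1) n hm).app (M k m n (i - 1))
  have hex := exact_tensorN k hm (m + n - 1) (M k m n (i - 1))
  have hepi : Epi β := epi_topToTensorN_app k hm _ _
  have hepi' : Epi (evalObj (tensorNMap k (m + n - 1) n hm) (topToTensorN k (m + n - 1) n hm)
    (tensorNMap_comp_topToTensorN k hm (m + n - 1)) (M k m n (i - 1))).g := hepi
  have hαβ : α ≫ β = 0 := congrArg (fun η => η.app (M k m n (i - 1)))
    (tensorNMap_comp_topToTensorN k hm (m + n - 1))
  -- The map `γ` is induced on the cokernel, and is then checked to be invertible at each vertex.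
  obtain ⟨γ, hγ⟩ : ∃ γ, β ≫ γ = topMToN k hm hi him :=
    ⟨hex.desc _ (tensorNMap_comp_topMToN k hm hi him), hex.g_desc _ _⟩
  have hiso : ∀ l, IsIso (γ.app l) := by
    intro l
    have hβ : Epi (β.app l) := inferInstance
    have hγ' : β.app l ≫ γ.app l = (topMToN k hm hi him).app l := congrArg (fun η => η.app l) hγ
    by_cases hl : (fiberEndFunctor m n i).obj l.2 ≤ l.1.unop
    · have h1 := isIso_topMToN_app k hm hi him l hl
      have h2 : Mono (β.app l) := mono_of_mono_fac hγ'
      have h3 : IsIso (β.app l) := isIso_of_mono_of_epi _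
      exact IsIso.of_isIso_fac_left hγ'
    -- Off the support of `restrictN` the map `α` is already onto, so the quotient is zero, as is
    -- the target.
    · have h0 : β.app l = 0 := by
        have h1 : Epi (α.app l) := epi_tensorNMap_M_app k hm hi l hl
        rw [← cancel_epi (α.app l), comp_zero]
        exact congrArg (fun η => η.app l) hαβ
      have h2 : IsZero (((tensorN k (m + n - 1) m n).obj (M k m n (i - 1))).obj l) := by
        rw [IsZero.iff_id_eq_zero, ← cancel_epi (β.app l), h0, zero_comp, zero_comp]
      exact h2.isIso (isZero_restrictN_obj k l hl) _
  have := NatIso.isIso_of_isIso_app γ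
  exact ⟨asIso γ ≪≫ (tensorMIso k hp).app _⟩

/-- The derived tensor products of bimodules are isomorphic. -/
lemma nonempty_onObject_iso (hp : 1 ≤ m + n - 1)
    [HasDerivedCategory.{w} (FDMod k ((Vertex (m + n - 1))ᵒᵖ × Vertex (m + n - 1)))]
    [HasDerivedCategory.{w} (FDMod k ((Vertex (m + n - 1))ᵒᵖ × Vertex m × Vertex n))]
    (hm : 1 ≤ m) (hi : 2 ≤ i) (him : i ≤ m)
    (tM : LeftDerived (tensorM k m n i)) (tN : LeftDerived (tensorN k (m + n - 1) m n)) :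
    Nonempty (tM.onObject (N k (m + n - 1)) ≅ tN.onObject (M k m n (i - 1))) := by
  have := preservesFiniteLimits_tensorM k (i := i) hp
  have := preservesFiniteColimits_tensorM k (i := i) hp
  obtain ⟨e⟩ := nonempty_tensorN_M_iso k hm hi him hp
  exact ⟨tM.onObjectIsoOfExact _ ≪≫ (DerivedCategory.singleFunctor _ 0).mapIso e.symm ≪≫
    (derivedConeSingleIso (tensorNMap k (m + n - 1) n hm) (topToTensorN k (m + n - 1) n hm)
      (tensorNMap_comp_topToTensorN k hm _) (exact_tensorN k hm _) (epi_topToTensorN_app k hm _)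
      (M k m n (i - 1)) (mono_tensorNMap_M k hm hi him)).symm ≪≫
    ((tN.totalIso (tensorNLeftDerived k (m + n - 1) n hm) (Iso.refl _)).app _).symm⟩

end

end Dias

open CategoryTheory Dias in
theorem mainTheorem4 (k : Type u) [Field k] (m n i : ℕ) (hn : 1 ≤ n) (hi : 2 ≤ i) (him : i ≤ m)
    [HasDerivedCategory.{w} (FDMod k (Vertex (m + n - 1)))]
    [HasDerivedCategory.{w} (FDMod k (Vertex m × Vertex n))]
    [HasDerivedCategory.{w} (FDMod k ((Vertex (m + n - 1))ᵒᵖ × Vertex (m + n - 1)))]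
    [HasDerivedCategory.{w} (FDMod k ((Vertex (m + n - 1))ᵒᵖ × Vertex m × Vertex n))] :
    -- the supports are injective, resp. projective, in the relevant directions, and
    -- the two fiber-reversals coincide
    (InjectiveDir (S m n i) 0 ∧ ProjectiveDir ![m + n - 1, m, n] (S m n (i - 1)) 1 ∧
      fiberReversalInj ![m + n - 1, m, n] (S m n i) 0 =
        fiberReversalProj ![m + n - 1, m, n] (S m n (i - 1)) 1) ∧
    -- the derived tensor products of bimodules exist and are isomorphic
    (Nonempty (LeftDerived (tensorM k m n i)) ∧
      Nonempty (LeftDerived (tensorN k (m + n - 1) m n)) ∧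
      ∀ (tM : LeftDerived (tensorM k m n i)) (tN : LeftDerived (tensorN k (m + n - 1) m n)),
        Nonempty (tM.onObject (N k (m + n - 1)) ≅ tN.onObject (M k m n (i - 1)))) ∧
    -- the functors on bounded derived categories exist, and satisfy the inner axiom
    (Nonempty (LeftDerived (nabla k m n i)) ∧ Nonempty (LeftDerived (nabla k m n (i - 1))) ∧
      Nonempty (LeftDerived (nakayama k (m + n - 1))) ∧
      Nonempty (LeftDerived (nakayamaProdId k m n)) ∧
      ∀ (nab : LeftDerived (nabla k m n i)) (nab' : LeftDerived (nabla k m n (i - 1)))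
        (nak : LeftDerived (nakayama k (m + n - 1)))
        (nakId : LeftDerived (nakayamaProdId k m n)),
        Nonempty (nak.translation ⋙ nab.onBounded ≅ nab'.onBounded ⋙ nakId.translation)) := by
  have hm : 1 ≤ m := by omega
  have hp : 1 ≤ m + n - 1 := by omega
  have hl (j : ℕ) := preservesFiniteLimits_nabla k (i := j) hp
  have hr (j : ℕ) := preservesFiniteColimits_nabla k (i := j) hp
  have := preservesFiniteLimits_tensorM k (i := i) hp
  have := preservesFiniteColimits_tensorM k (i := i) hp
  exact ⟨⟨injectiveDir_S m n i, projectiveDir_S m n (i - 1), fiberReversal_S hi him⟩,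
    ⟨⟨LeftDerived.ofExact _⟩, ⟨tensorNLeftDerived k _ n hm⟩,
      nonempty_onObject_iso k hp hm hi him⟩,
    ⟨LeftDerived.ofExact _⟩, ⟨LeftDerived.ofExact _⟩, ⟨nakayamaLeftDerived k hp⟩,
    ⟨nakayamaProdIdLeftDerived k n hm⟩, fun nab nab' nak nakId =>
      ⟨translationCompIso nak nab nab' nakId (derivedNakayamaCompIso k hm hp hi him nab nab' nak nakId)
        (nablaShiftIso k hp nab)⟩⟩
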